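/- Let $q\in(0,1)$. Let ${\rm Pol}(\mathbb C)_q$ be the unital complex algebra with generators $z,z^*$ and the relation $z^*z=q^2zz^*+1-q^2$; the monomials $z^iz^{*j}$ form a basis of it. Let $\Omega_q(\mathbb C)$ be the involutive algebra with generators $z,z^*,dz,dz^*$, the relation above, the relations $$dz\,z^*=q^{-2}z^*dz,\quad dz\,z=q^2z\,dz,\quad dz\,dz^*=-q^{-2}dz^*dz,\quad dz\,dz=0,$$ and their images under the involution $z\mapsto z^*$, $dz\mapsto dz^*$. Let $d$ be the graded derivation of $\Omega_q(\mathbb C)$ with $z\mapsto dz$, $z^*\mapsto dz^*$, $dz\mapsto 0$, $dz^*\mapsto 0$. The partial derivatives are the linear operators on ${\rm Pol}(\mathbb C)_q$ with $$df=dz\cdot\frac{\partial^{(l)}f}{\partial z}+dz^*\cdot\frac{\partial^{(l)}f}{\partial z^*}=\frac{\partial^{(r)}f}{\partial z}\cdot dz+\frac{\partial^{(r)}f}{\partial z^*}\cdot dz^*.$$ Write $(a;q^2)_m=\prod_{i=0}^{m-1}(1-q^{2i}a)$. For $t\in(0,1)$ let $\widehat z$ be the bounded operator $\widehat ze_m=e_{m+1}$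 $(m\ge 0)$ on the Hilbert space with complete orthogonal system $(e_m)_{m\ge0}$ such that $\|e_m\|^2=(q^2;q^2)_m/(q^2t;q^2)_m$, and let $\widehat z^*$ be its adjoint. For $f=\sum a_{ij}z^iz^{*j}\in{\rm Pol}(\mathbb C)_q$ (a finite sum) put $\widehat f=\sum a_{ij}\widehat z^i\widehat z^{*j}$. A formal series $\sum a_{ij}z^iz^{*j}$ is a covariant symbol of a bounded operator $A$ if $Ae_m=\sum_{i,j}a_{ij}\widehat z^i\widehat z^{*j}e_m$ for every $m$, the sum being unconditionally convergent. For $f_1,f_2\in{\rm Pol}(\mathbb C)_q$, the product $f_1*f_2$ is the formal series $F=\sum_nt^nF_n\in{\rm Pol}(\mathbb C)_q[[t]]$ defined by $\widehat{f_1*f_2}=\widehat{f_1}\widehat{f_2}$, that is: for every $t\in(0,1)$ and all $i,j$, the coefficients of $z^iz^{*j}$ in $t^nF_n$ have a convergent sum $a_{ij}(t)$ over $n$, and $\sum_{i,j}a_{ij}(t)z^iz^{*j}$ is a covariant symbol of $\widehat{f_1}\widehat{f_2}$. **Theorem.** For all $f_1,f_2\in{\rm Pol}(\mathbb C)_q$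 there is exactly one such series $f_1*f_2$, and in ${\rm Pol}(\mathbb C)_q[[t]]$ $$f_1*f_2=(1-t)\sum_{j=0}^\infty t^j\,m\bigl(p_j(\tilde\Box)(f_1\otimes f_2)\bigr),$$ where $m$ is the multiplication ${\rm Pol}(\mathbb C)_q\otimes{\rm Pol}(\mathbb C)_q\to{\rm Pol}(\mathbb C)_q$, where $$\tilde\Box=q^{-2}\bigl(1-(1+q^{-2})\,z^*\otimes z+q^{-2}\,z^{*2}\otimes z^2\bigr)\cdot\frac{\partial^{(r)}}{\partial z^*}\otimes\frac{\partial^{(l)}}{\partial z},$$ with $z^{*k}\otimes z^k$ acting by $f\otimes g\mapsto fz^{*k}\otimes z^kg$, and where $$p_j(\tilde\Box)=\sum_{k=0}^j\frac{(q^{-2j};q^2)_k}{(q^2;q^2)_k^2}\,q^{2k}\prod_{i=0}^{k-1}\Bigl(1-q^{2i}\bigl((1-q^2)^2\tilde\Box+1+q^2\bigr)+q^{4i+2}\Bigr).$$ -/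

import Mathlib

open scoped TensorProduct

namespace QDisc

noncomputable section

/-- The parameters `q` and `t` range over the open interval `(0,1)`. -/
abbrev Param : Type := Set.Ioo (0 : ℝ) 1

/-- A parameter regarded as a complex number. -/
def Param.c (q : Param) : ℂ := ((q : ℝ) : ℂ)

theorem Param.c_ne_zero (q : Param) : q.c ≠ 0 := by
  have h := q.2.1
  simpa [Param.c] using h.ne'

/-- The `q`-shifted factorial `(a; Q)_m = (1 - a)(1 - Q a) ⋯ (1 - Q^(m-1) a)`. -/
def qPoch {K : Type*} [CommRing K] (a Q : K) (m : ℕ) : K :=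
  ∏ i ∈ Finset.range m, (1 - Q ^ i * a)

/-! ### The algebra `Pol(ℂ)_q` -/

/-- The generators `z` and `z^*`. -/
inductive PolGen : Type
  | z : PolGen
  | zs : PolGen

/-- The defining relation `z^* z = q² z z^* + 1 - q²`. -/
inductive PolRel (q : Param) : FreeAlgebra ℂ PolGen → FreeAlgebra ℂ PolGen → Prop
  | comm : PolRel q
      (FreeAlgebra.ι ℂ PolGen.zs * FreeAlgebra.ι ℂ PolGen.z)
      (q.c ^ 2 • (FreeAlgebra.ι ℂ PolGen.z * FreeAlgebra.ι ℂ PolGen.zs) + (1 - q.c ^ 2) • 1)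

/-- `Pol(ℂ)_q`: the unital complex algebra with generators `z`, `z^*` and the relation
`z^* z = q² z z^* + 1 - q²`. -/
def Pol (q : Param) : Type := RingQuot (PolRel q)

instance (q : Param) : Ring (Pol q) := inferInstanceAs (Ring (RingQuot (PolRel q)))

instance (q : Param) : Algebra ℂ (Pol q) := inferInstanceAs (Algebra ℂ (RingQuot (PolRel q)))

namespace Pol

variable (q : Param)

/-- The canonical map of the free algebra onto `Pol(ℂ)_q`. -/
def proj : FreeAlgebra ℂ PolGen →ₐ[ℂ] Pol q := RingQuot.mkAlgHom ℂ (PolRel q)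

/-- The generator `z`. -/
def z : Pol q := proj q (FreeAlgebra.ι ℂ PolGen.z)

/-- The generator `z^*`. -/
def zs : Pol q := proj q (FreeAlgebra.ι ℂ PolGen.zs)

theorem zs_mul_z : zs q * z q = q.c ^ 2 • (z q * zs q) + (1 - q.c ^ 2) • 1 := by
  have h : proj q _ = proj q _ := RingQuot.mkAlgHom_rel ℂ (PolRel.comm (q := q))
  simpa only [z, zs, map_mul, map_add, map_smul, map_one] using h

variable {q}

/-- Values on the generators. -/
def genMap {A : Type*} (a b : A) : PolGen → A
  | .z => a
  | .zs => b

theorem genMap_rel {A : Type*} [Ring A] [Algebra ℂ A] {a b : A}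
    (h : b * a = q.c ^ 2 • (a * b) + (1 - q.c ^ 2) • 1)
    ⦃x y : FreeAlgebra ℂ PolGen⦄ (r : PolRel q x y) :
    FreeAlgebra.lift ℂ (genMap a b) x = FreeAlgebra.lift ℂ (genMap a b) y := by
  cases r
  simpa [genMap] using h

/-- The universal property of `Pol(ℂ)_q`. -/
def lift {A : Type*} [Ring A] [Algebra ℂ A] (a b : A)
    (h : b * a = q.c ^ 2 • (a * b) + (1 - q.c ^ 2) • 1) : Pol q →ₐ[ℂ] A :=
  RingQuot.liftAlgHom ℂ ⟨FreeAlgebra.lift ℂ (genMap a b), genMap_rel h⟩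

theorem lift_proj {A : Type*} [Ring A] [Algebra ℂ A] (a b : A)
    (h : b * a = q.c ^ 2 • (a * b) + (1 - q.c ^ 2) • 1) (g : PolGen) :
    lift a b h (proj q (FreeAlgebra.ι ℂ g)) = genMap a b g := by
  have := RingQuot.liftAlgHom_mkAlgHom_apply (S := ℂ)
    (FreeAlgebra.lift ℂ (genMap a b)) (s := PolRel q) (genMap_rel h) (FreeAlgebra.ι ℂ g)
  refine Eq.trans this ?_
  simp

theorem lift_z {A : Type*} [Ring A] [Algebra ℂ A] (a b : A)
    (h : b * a = q.c ^ 2 • (a * b) + (1 - q.c ^ 2) • 1) : lift a b h (z q) = a :=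
  lift_proj a b h PolGen.z

theorem lift_zs {A : Type*} [Ring A] [Algebra ℂ A] (a b : A)
    (h : b * a = q.c ^ 2 • (a * b) + (1 - q.c ^ 2) • 1) : lift a b h (zs q) = b :=
  lift_proj a b h PolGen.zs

/-- Induction along the algebra structure. -/
theorem induction {P : Pol q → Prop} (hc : ∀ r : ℂ, P (algebraMap ℂ (Pol q) r))
    (hz : P (z q)) (hzs : P (zs q)) (hadd : ∀ a b, P a → P b → P (a + b))
    (hmul : ∀ a b, P a → P b → P (a * b)) (f : Pol q) : P f := by
  obtain ⟨x, rfl⟩ := RingQuot.mkAlgHom_surjective ℂ (PolRel q) f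
  change P (proj q x)
  induction x using FreeAlgebra.induction with
  | grade0 r => simpa using hc r
  | grade1 g => cases g; exacts [hz, hzs]
  | mul a b ha hb => simpa using hmul _ _ ha hb
  | add a b ha hb => simpa using hadd _ _ ha hb

/-! The monomials `z^i z^{*j}` form a basis of `Pol(ℂ)_q`. -/

/-- The left multiplication by `z` in terms of coefficients. -/
def coeffZ : ((ℕ × ℕ) →₀ ℂ) →ₗ[ℂ] ((ℕ × ℕ) →₀ ℂ) :=
  Finsupp.lsum ℂ fun ij => Finsupp.lsingle (ij.1 + 1, ij.2)

/-- The left multiplication by `z^*` in terms of coefficients. -/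
def coeffZs (q : Param) : ((ℕ × ℕ) →₀ ℂ) →ₗ[ℂ] ((ℕ × ℕ) →₀ ℂ) :=
  Finsupp.lsum ℂ fun ij =>
    q.c ^ (2 * ij.1) • Finsupp.lsingle (ij.1, ij.2 + 1) +
      (1 - q.c ^ (2 * ij.1)) • Finsupp.lsingle (ij.1 - 1, ij.2)

theorem coeffZ_single (i j : ℕ) (c : ℂ) :
    coeffZ (Finsupp.single (i, j) c) = Finsupp.single (i + 1, j) c := by
  simp [coeffZ]

theorem coeffZs_single (i j : ℕ) (c : ℂ) :
    coeffZs q (Finsupp.single (i, j) c) =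
      q.c ^ (2 * i) • Finsupp.single (i, j + 1) c +
        (1 - q.c ^ (2 * i)) • Finsupp.single (i - 1, j) c := by
  simp [coeffZs]

/-- The action of `Pol(ℂ)_q` by left multiplication in terms of coefficients. -/
def coeffAct (q : Param) : Pol q →ₐ[ℂ] Module.End ℂ ((ℕ × ℕ) →₀ ℂ) :=
  lift coeffZ (coeffZs q) (by
    ext ⟨i, j⟩ : 2
    simp only [LinearMap.comp_apply, Module.End.mul_apply, Finsupp.lsingle_apply,
      LinearMap.add_apply, LinearMap.smul_apply, Module.End.one_apply, coeffZ_single,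
      coeffZs_single, map_add, map_smul]
    rcases i with _ | i
    · simp
    · simp only [Nat.add_sub_cancel]
      module)

theorem zs_mul_z_pow (i : ℕ) :
    zs q * z q ^ i = q.c ^ (2 * i) • (z q ^ i * zs q) + (1 - q.c ^ (2 * i)) • z q ^ (i - 1) := by
  induction i with
  | zero => simp
  | succ i ih =>
    rcases i with _ | i
    · simpa using zs_mul_z q
    · rw [pow_succ, ← mul_assoc, ih, add_mul, smul_mul_assoc, smul_mul_assoc, mul_assoc,
        zs_mul_z]
      simp only [Nat.add_sub_cancel, mul_add, mul_smul_comm, mul_one, ← mul_assoc, ← pow_succ]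
      module

/-- The coefficients of an element in the monomials `z^i z^{*j}`. -/
def coeffMap (q : Param) : Pol q →ₗ[ℂ] ((ℕ × ℕ) →₀ ℂ) where
  toFun f := coeffAct q f (Finsupp.single (0, 0) 1)
  map_add' f g := by simp
  map_smul' c f := by simp

/-- The element with given coefficients in the monomials `z^i z^{*j}`. -/
def ofCoeff (q : Param) : ((ℕ × ℕ) →₀ ℂ) →ₗ[ℂ] Pol q :=
  Finsupp.lsum ℂ fun ij => LinearMap.toSpanSingleton ℂ (Pol q) (z q ^ ij.1 * zs q ^ ij.2)

theorem ofCoeff_single (i j : ℕ) (c : ℂ) :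
    ofCoeff q (Finsupp.single (i, j) c) = c • (z q ^ i * zs q ^ j) := by
  simp [ofCoeff]

theorem coeffMap_monomial (i j : ℕ) :
    coeffMap q (z q ^ i * zs q ^ j) = Finsupp.single (i, j) 1 := by
  have h1 : ∀ j, ((coeffZs q) ^ j) (Finsupp.single (0, 0) 1) = Finsupp.single (0, j) 1 := by
    intro j
    induction j with
    | zero => simp
    | succ j ih => rw [pow_succ', Module.End.mul_apply, ih, coeffZs_single]; simp
  have h2 : ∀ i, (coeffZ ^ i) (Finsupp.single (0, j) 1) = Finsupp.single (i, j) 1 := by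
    intro i
    induction i with
    | zero => simp
    | succ i ih => rw [pow_succ', Module.End.mul_apply, ih, coeffZ_single]
  change coeffAct q (z q ^ i * zs q ^ j) _ = _
  rw [map_mul, map_pow, map_pow, coeffAct, lift_z, lift_zs, Module.End.mul_apply, h1, h2]

theorem ofCoeff_coeffAct (f : Pol q) :
    ∀ v, ofCoeff q (coeffAct q f v) = f * ofCoeff q v := by
  induction f using Pol.induction with
  | hc r => intro v; simp [Algebra.smul_def]
  | hz =>
    intro v
    induction v using Finsupp.induction_linear with
    | zero => simp
    | add a b ha hb => simp [mul_add, ha, hb]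
    | single ij c =>
      obtain ⟨i, j⟩ := ij
      rw [coeffAct, lift_z, coeffZ_single, ofCoeff_single, ofCoeff_single, pow_succ',
        mul_smul_comm, mul_assoc]
  | hzs =>
    intro v
    induction v using Finsupp.induction_linear with
    | zero => simp
    | add a b ha hb => simp [mul_add, ha, hb]
    | single ij c =>
      obtain ⟨i, j⟩ := ij
      rw [coeffAct, lift_zs, coeffZs_single, map_add, map_smul, map_smul, ofCoeff_single,
        ofCoeff_single, ofCoeff_single, mul_smul_comm, ← mul_assoc, zs_mul_z_pow, add_mul,
        smul_mul_assoc, smul_mul_assoc, mul_assoc, pow_succ']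
      module
  | hadd a b ha hb => intro v; simp [ha, hb, add_mul]
  | hmul a b ha hb => intro v; simp [ha, hb, mul_assoc]

/-- The basis of `Pol(ℂ)_q` formed by the monomials `z^i z^{*j}`. -/
def basis (q : Param) : Module.Basis (ℕ × ℕ) ℂ (Pol q) :=
  Module.Basis.ofRepr <| LinearEquiv.ofLinearMap (coeffMap q) (ofCoeff q)
    (by
      ext ⟨i, j⟩ : 2
      simp only [LinearMap.comp_apply, Finsupp.lsingle_apply, ofCoeff_single, one_smul,
        coeffMap_monomial, LinearMap.id_apply])
    (by
      refine LinearMap.ext fun f => ?_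
      change ofCoeff q (coeffAct q f _) = f
      rw [ofCoeff_coeffAct, ofCoeff_single]
      simp)

theorem basis_apply (i j : ℕ) : basis q (i, j) = z q ^ i * zs q ^ j := by
  change ofCoeff q (Finsupp.single (i, j) 1) = _
  rw [ofCoeff_single, one_smul]

end Pol

/-! ### The differential calculus `Ω_q(ℂ)` -/

/-- The generators `z`, `z^*`, `dz`, `dz^*`. -/
inductive FormGen : Type
  | z : FormGen
  | zs : FormGen
  | dz : FormGen
  | dzs : FormGen

open FormGen in
/-- The defining relations of `Ω_q(ℂ)`, together with their images under the involution
`z ↦ z^*`, `dz ↦ dz^*`. -/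
inductive FormRel (q : Param) : FreeAlgebra ℂ FormGen → FreeAlgebra ℂ FormGen → Prop
  | zs_z : FormRel q (FreeAlgebra.ι ℂ zs * FreeAlgebra.ι ℂ z)
      (q.c ^ 2 • (FreeAlgebra.ι ℂ z * FreeAlgebra.ι ℂ zs) + (1 - q.c ^ 2) • 1)
  | dz_zs : FormRel q (FreeAlgebra.ι ℂ dz * FreeAlgebra.ι ℂ zs)
      ((q.c ^ 2)⁻¹ • (FreeAlgebra.ι ℂ zs * FreeAlgebra.ι ℂ dz))
  | dz_z : FormRel q (FreeAlgebra.ι ℂ dz * FreeAlgebra.ι ℂ z)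
      (q.c ^ 2 • (FreeAlgebra.ι ℂ z * FreeAlgebra.ι ℂ dz))
  | dz_dzs : FormRel q (FreeAlgebra.ι ℂ dz * FreeAlgebra.ι ℂ dzs)
      (-(q.c ^ 2)⁻¹ • (FreeAlgebra.ι ℂ dzs * FreeAlgebra.ι ℂ dz))
  | dz_dz : FormRel q (FreeAlgebra.ι ℂ dz * FreeAlgebra.ι ℂ dz) 0
  | z_dzs : FormRel q (FreeAlgebra.ι ℂ z * FreeAlgebra.ι ℂ dzs)
      ((q.c ^ 2)⁻¹ • (FreeAlgebra.ι ℂ dzs * FreeAlgebra.ι ℂ z))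
  | zs_dzs : FormRel q (FreeAlgebra.ι ℂ zs * FreeAlgebra.ι ℂ dzs)
      (q.c ^ 2 • (FreeAlgebra.ι ℂ dzs * FreeAlgebra.ι ℂ zs))
  | dzs_dzs : FormRel q (FreeAlgebra.ι ℂ dzs * FreeAlgebra.ι ℂ dzs) 0

/-- The algebra `Ω_q(ℂ)` of differential forms. -/
def Form (q : Param) : Type := RingQuot (FormRel q)

instance (q : Param) : Ring (Form q) := inferInstanceAs (Ring (RingQuot (FormRel q)))

instance (q : Param) : Algebra ℂ (Form q) := inferInstanceAs (Algebra ℂ (RingQuot (FormRel q)))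

/-- Images `a, b, u, v` of `z, z^*, dz, dz^*` that satisfy the relations of `Ω_q(ℂ)`. -/
structure FormRelations {A : Type*} [Ring A] [Algebra ℂ A] (q : Param) (a b u v : A) : Prop where
  zs_z : b * a = q.c ^ 2 • (a * b) + (1 - q.c ^ 2) • 1
  dz_zs : u * b = (q.c ^ 2)⁻¹ • (b * u)
  dz_z : u * a = q.c ^ 2 • (a * u)
  dz_dzs : u * v = -(q.c ^ 2)⁻¹ • (v * u)
  dz_dz : u * u = 0
  z_dzs : a * v = (q.c ^ 2)⁻¹ • (v * a)
  zs_dzs : b * v = q.c ^ 2 • (v * b)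
  dzs_dzs : v * v = 0

namespace Form

variable (q : Param)

/-- The canonical map of the free algebra onto `Ω_q(ℂ)`. -/
def proj : FreeAlgebra ℂ FormGen →ₐ[ℂ] Form q := RingQuot.mkAlgHom ℂ (FormRel q)

/-- The generator `z`. -/
def z : Form q := proj q (FreeAlgebra.ι ℂ FormGen.z)

/-- The generator `z^*`. -/
def zs : Form q := proj q (FreeAlgebra.ι ℂ FormGen.zs)

/-- The generator `dz`. -/
def dz : Form q := proj q (FreeAlgebra.ι ℂ FormGen.dz)

/-- The generator `dz^*`. -/
def dzs : Form q := proj q (FreeAlgebra.ι ℂ FormGen.dzs)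

theorem relations : FormRelations q (z q) (zs q) (dz q) (dzs q) := by
  have h {x y} (r : FormRel q x y) : proj q x = proj q y := RingQuot.mkAlgHom_rel ℂ r
  constructor
  · simpa only [z, zs, map_mul, map_add, map_smul, map_one] using h FormRel.zs_z
  · simpa only [z, zs, dz, dzs, map_mul, map_smul] using h FormRel.dz_zs
  · simpa only [z, zs, dz, dzs, map_mul, map_smul] using h FormRel.dz_z
  · simpa only [z, zs, dz, dzs, map_mul, map_smul] using h FormRel.dz_dzs
  · simpa only [z, zs, dz, dzs, map_mul, map_zero] using h FormRel.dz_dz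
  · simpa only [z, zs, dz, dzs, map_mul, map_smul] using h FormRel.z_dzs
  · simpa only [z, zs, dz, dzs, map_mul, map_smul] using h FormRel.zs_dzs
  · simpa only [z, zs, dz, dzs, map_mul, map_zero] using h FormRel.dzs_dzs

variable {q}

/-- Values on the generators. -/
def genMap {A : Type*} (a b u v : A) : FormGen → A
  | .z => a
  | .zs => b
  | .dz => u
  | .dzs => v

theorem genMap_rel {A : Type*} [Ring A] [Algebra ℂ A] {a b u v : A}
    (h : FormRelations q a b u v) ⦃x y : FreeAlgebra ℂ FormGen⦄ (r : FormRel q x y) :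
    FreeAlgebra.lift ℂ (genMap a b u v) x = FreeAlgebra.lift ℂ (genMap a b u v) y := by
  cases r
  · simpa [genMap] using h.zs_z
  · simpa [genMap] using h.dz_zs
  · simpa [genMap] using h.dz_z
  · simpa [genMap] using h.dz_dzs
  · simpa [genMap] using h.dz_dz
  · simpa [genMap] using h.z_dzs
  · simpa [genMap] using h.zs_dzs
  · simpa [genMap] using h.dzs_dzs

/-- The universal property of `Ω_q(ℂ)`. -/
def lift {A : Type*} [Ring A] [Algebra ℂ A] {a b u v : A}
    (h : FormRelations q a b u v) : Form q →ₐ[ℂ] A :=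
  RingQuot.liftAlgHom ℂ ⟨FreeAlgebra.lift ℂ (genMap a b u v), genMap_rel h⟩

theorem lift_proj {A : Type*} [Ring A] [Algebra ℂ A] {a b u v : A}
    (h : FormRelations q a b u v) (g : FormGen) :
    lift h (proj q (FreeAlgebra.ι ℂ g)) = genMap a b u v g := by
  have := RingQuot.liftAlgHom_mkAlgHom_apply (S := ℂ)
    (FreeAlgebra.lift ℂ (genMap a b u v)) (s := FormRel q) (genMap_rel h) (FreeAlgebra.ι ℂ g)
  refine Eq.trans this ?_
  simp

theorem algHom_ext {A : Type*} [Ring A] [Algebra ℂ A] {φ ψ : Form q →ₐ[ℂ] A}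
    (hz : φ (z q) = ψ (z q)) (hzs : φ (zs q) = ψ (zs q)) (hdz : φ (dz q) = ψ (dz q))
    (hdzs : φ (dzs q) = ψ (dzs q)) : φ = ψ := by
  refine RingQuot.ringQuot_ext' ℂ φ ψ ?_
  ext g
  cases g
  exacts [hz, hzs, hdz, hdzs]

/-- The inclusion of `Pol(ℂ)_q` in `Ω_q(ℂ)`. -/
def ofPol (q : Param) : Pol q →ₐ[ℂ] Form q := Pol.lift (z q) (zs q) (relations q).zs_z

theorem ofPol_z : ofPol q (Pol.z q) = z q := Pol.lift_z _ _ _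

theorem ofPol_zs : ofPol q (Pol.zs q) = zs q := Pol.lift_zs _ _ _

/-- The grading involution `ω ↦ (-1)^(deg ω) ω`. -/
def parity (q : Param) : Form q →ₐ[ℂ] Form q :=
  lift (a := z q) (b := zs q) (u := -dz q) (v := -dzs q) (by
    have h := relations q
    constructor
    · exact h.zs_z
    · simp [h.dz_zs]
    · simp [h.dz_z]
    · simp [h.dz_dzs]
    · simp [h.dz_dz]
    · simp [h.z_dzs]
    · simp [h.zs_dzs]
    · simp [h.dzs_dzs])

/-- The matrix `!![(-1)^(deg ω) ω, dω; 0, ω]` of a form `ω`. Its multiplicativity is the graded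
Leibniz rule for `d`. -/
def dMatrix (q : Param) : Form q →ₐ[ℂ] Matrix (Fin 2) (Fin 2) (Form q) :=
  lift (a := !![z q, dz q; 0, z q]) (b := !![zs q, dzs q; 0, zs q])
    (u := !![-dz q, 0; 0, dz q]) (v := !![-dzs q, 0; 0, dzs q]) (by
    have h := relations q
    have hq := q.c_ne_zero
    have h1 : dzs q * z q = q.c ^ 2 • (z q * dzs q) := by
      rw [h.z_dzs, smul_smul, mul_inv_cancel₀ (pow_ne_zero 2 hq), one_smul]
    have h2 : zs q * dz q = q.c ^ 2 • (dz q * zs q) := by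
      rw [h.dz_zs, smul_smul, mul_inv_cancel₀ (pow_ne_zero 2 hq), one_smul]
    have h3 : dzs q * dz q = -(q.c ^ 2 • (dz q * dzs q)) := by
      rw [h.dz_dzs, smul_smul, mul_neg, mul_inv_cancel₀ (pow_ne_zero 2 hq)]
      simp
    constructor <;> ext i j <;> fin_cases i <;> fin_cases j <;>
      simp [Matrix.mul_apply, Fin.sum_univ_two, h.zs_z, h.dz_zs, h.dz_z,
        h.dz_dzs, h.dz_dz, h.z_dzs, h.zs_dzs, h.dzs_dzs, smul_smul, hq]
    exact add_comm _ _)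

/-- The differential `d` of `Ω_q(ℂ)`. -/
def d (q : Param) : Form q →ₗ[ℂ] Form q where
  toFun ω := dMatrix q ω 0 1
  map_add' := by simp
  map_smul' := by simp


/-- Induction along the algebra structure. -/
theorem induction {P : Form q → Prop} (hc : ∀ r : ℂ, P (algebraMap ℂ (Form q) r))
    (hz : P (z q)) (hzs : P (zs q)) (hdz : P (dz q)) (hdzs : P (dzs q))
    (hadd : ∀ a b, P a → P b → P (a + b))
    (hmul : ∀ a b, P a → P b → P (a * b)) (ω : Form q) : P ω := by
  obtain ⟨x, rfl⟩ := RingQuot.mkAlgHom_surjective ℂ (FormRel q) ω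
  change P (proj q x)
  induction x using FreeAlgebra.induction with
  | grade0 r => simpa using hc r
  | grade1 g => cases g; exacts [hz, hzs, hdz, hdzs]
  | mul a b ha hb => simpa using hmul _ _ ha hb
  | add a b ha hb => simpa using hadd _ _ ha hb

theorem dMatrix_entries (ω : Form q) :
    dMatrix q ω 1 0 = 0 ∧ dMatrix q ω 1 1 = ω ∧ dMatrix q ω 0 0 = parity q ω := by
  induction ω using Form.induction with
  | hc r => simp [Matrix.algebraMap_matrix_apply]
  | hz => simp [dMatrix, parity, z, lift_proj, genMap]
  | hzs => simp [dMatrix, parity, zs, lift_proj, genMap]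
  | hdz => simp [dMatrix, parity, dz, lift_proj, genMap]
  | hdzs => simp [dMatrix, parity, dzs, lift_proj, genMap]
  | hadd a b ha hb => simp [ha, hb]
  | hmul a b ha hb => simp [Matrix.mul_apply, Fin.sum_univ_two, ha, hb]

theorem d_z : d q (z q) = dz q := by
  simp [d, dMatrix, z, dz, lift_proj, genMap]

theorem d_zs : d q (zs q) = dzs q := by
  simp [d, dMatrix, zs, dzs, lift_proj, genMap]

theorem d_dz : d q (dz q) = 0 := by
  simp [d, dMatrix, dz, lift_proj, genMap]

theorem d_dzs : d q (dzs q) = 0 := by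
  simp [d, dMatrix, dzs, lift_proj, genMap]

theorem d_algebraMap (r : ℂ) : d q (algebraMap ℂ (Form q) r) = 0 := by
  simp [d, Matrix.algebraMap_matrix_apply]

/-- The graded Leibniz rule. -/
theorem d_mul (ω η : Form q) : d q (ω * η) = d q ω * η + parity q ω * d q η := by
  change dMatrix q (ω * η) 0 1 = dMatrix q ω 0 1 * η + parity q ω * dMatrix q η 0 1
  rw [map_mul, Matrix.mul_apply, Fin.sum_univ_two, (dMatrix_entries ω).2.2,
    (dMatrix_entries η).2.1, add_comm]

theorem parity_ofPol (f : Pol q) : parity q (ofPol q f) = ofPol q f := by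
  induction f using Pol.induction with
  | hc r => simp
  | hz => simp [ofPol_z, parity, z, lift_proj, genMap]
  | hzs => simp [ofPol_zs, parity, zs, lift_proj, genMap]
  | hadd a b ha hb => simp [ha, hb]
  | hmul a b ha hb => simp [ha, hb]

/-- The automorphism `z ↦ c z`, `z^* ↦ c⁻¹ z^*` of `Pol(ℂ)_q`. -/
def twist (q : Param) {c : ℂ} (hc : c ≠ 0) : Pol q →ₐ[ℂ] Pol q :=
  Pol.lift (c • Pol.z q) (c⁻¹ • Pol.zs q) (by simp [smul_smul, hc, Pol.zs_mul_z])

theorem twist_z {c : ℂ} (hc : c ≠ 0) : twist q hc (Pol.z q) = c • Pol.z q := Pol.lift_z _ _ _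

theorem twist_zs {c : ℂ} (hc : c ≠ 0) : twist q hc (Pol.zs q) = c⁻¹ • Pol.zs q :=
  Pol.lift_zs _ _ _

theorem twist_twist {b c : ℂ} (hb : b ≠ 0) (hc : c ≠ 0) (h : c * b = 1) (f : Pol q) :
    twist q hb (twist q hc f) = f := by
  have h' : c⁻¹ * b⁻¹ = 1 := by rw [← mul_inv, h, inv_one]
  induction f using Pol.induction with
  | hc r => simp
  | hz => simp [twist_z, smul_smul, h]
  | hzs => simp only [twist_zs, map_smul, smul_smul, h', one_smul]
  | hadd a b ha hb => simp [ha, hb]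
  | hmul a b ha hb => simp [ha, hb]

theorem sq_ne_zero' (q : Param) : q.c ^ 2 ≠ 0 := pow_ne_zero 2 q.c_ne_zero

/-- The commutation automorphism: `dz f = σ(f) dz` and `dz^* f = σ(f) dz^*`. -/
def sigma (q : Param) : Pol q →ₐ[ℂ] Pol q := twist q (sq_ne_zero' q)

/-- The inverse of `sigma`. -/
def sigmaInv (q : Param) : Pol q →ₐ[ℂ] Pol q := twist q (inv_ne_zero (sq_ne_zero' q))

theorem sigma_sigmaInv (f : Pol q) : sigma q (sigmaInv q f) = f :=
  twist_twist _ _ (inv_mul_cancel₀ (sq_ne_zero' q)) f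

theorem sigmaInv_sigma (f : Pol q) : sigmaInv q (sigma q f) = f :=
  twist_twist _ _ (mul_inv_cancel₀ (sq_ne_zero' q)) f

theorem dz_mul (f : Pol q) : dz q * ofPol q f = ofPol q (sigma q f) * dz q := by
  have h := relations q
  induction f using Pol.induction with
  | hc r => simp [Algebra.commutes]
  | hz => simp [sigma, ofPol_z, twist_z, h.dz_z]
  | hzs => simp only [sigma, twist_zs, map_smul, ofPol_zs, h.dz_zs, smul_mul_assoc]
  | hadd a b ha hb => simp [ha, hb, mul_add, add_mul]
  | hmul a b ha hb => rw [map_mul, ← mul_assoc, ha, mul_assoc, hb, map_mul, map_mul, mul_assoc]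

theorem dzs_mul (f : Pol q) : dzs q * ofPol q f = ofPol q (sigma q f) * dzs q := by
  have h := relations q
  induction f using Pol.induction with
  | hc r => simp [Algebra.commutes]
  | hz =>
    simp [sigma, ofPol_z, twist_z, h.z_dzs, smul_smul, q.c_ne_zero]
  | hzs =>
    simp [sigma, ofPol_zs, twist_zs, h.zs_dzs, smul_smul, q.c_ne_zero]
  | hadd a b ha hb => simp [ha, hb, mul_add, add_mul]
  | hmul a b ha hb => rw [map_mul, ← mul_assoc, ha, mul_assoc, hb, map_mul, map_mul, mul_assoc]

theorem exists_d_eq (f : Pol q) :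
    ∃ a b : Pol q, d q (ofPol q f) = ofPol q a * dz q + ofPol q b * dzs q := by
  induction f using Pol.induction with
  | hc r => exact ⟨0, 0, by rw [AlgHom.commutes, d_algebraMap]; simp⟩
  | hz => exact ⟨1, 0, by simp [ofPol_z, d_z]⟩
  | hzs => exact ⟨0, 1, by simp [ofPol_zs, d_zs]⟩
  | hadd f g hf hg =>
    obtain ⟨a, b, h⟩ := hf
    obtain ⟨a', b', h'⟩ := hg
    refine ⟨a + a', b + b', ?_⟩
    simp only [map_add, h, h', add_mul]
    abel
  | hmul f g hf hg =>
    obtain ⟨a, b, h⟩ := hf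
    obtain ⟨a', b', h'⟩ := hg
    refine ⟨a * sigma q g + f * a', b * sigma q g + f * b', ?_⟩
    rw [map_mul, d_mul, h, h', parity_ofPol]
    simp only [map_add, map_mul, add_mul, mul_add, mul_assoc, dz_mul, dzs_mul]
    abel

/-- A representation of `Ω_q(ℂ)` that reads off the coefficient of `dz`. -/
def readDz (q : Param) : Form q →ₐ[ℂ] Matrix (Fin 2) (Fin 2) (Pol q) :=
  lift (a := !![Pol.z q, 0; 0, q.c ^ 2 • Pol.z q])
    (b := !![Pol.zs q, 0; 0, (q.c ^ 2)⁻¹ • Pol.zs q]) (u := !![0, 1; 0, 0]) (v := 0) (by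
    have hq := q.c_ne_zero
    constructor <;> ext i j <;> fin_cases i <;> fin_cases j <;>
      simp [Matrix.mul_apply, Fin.sum_univ_two, Pol.zs_mul_z, smul_smul, hq])

/-- A representation of `Ω_q(ℂ)` that reads off the coefficient of `dz^*`. -/
def readDzs (q : Param) : Form q →ₐ[ℂ] Matrix (Fin 2) (Fin 2) (Pol q) :=
  lift (a := !![Pol.z q, 0; 0, q.c ^ 2 • Pol.z q])
    (b := !![Pol.zs q, 0; 0, (q.c ^ 2)⁻¹ • Pol.zs q]) (u := 0) (v := !![0, 1; 0, 0]) (by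
    have hq := q.c_ne_zero
    constructor <;> ext i j <;> fin_cases i <;> fin_cases j <;>
      simp [Matrix.mul_apply, Fin.sum_univ_two, Pol.zs_mul_z, smul_smul, hq])

theorem readDz_ofPol (f : Pol q) : readDz q (ofPol q f) = !![f, 0; 0, sigma q f] := by
  induction f using Pol.induction with
  | hc r => ext i j; fin_cases i <;> fin_cases j <;> simp [Matrix.algebraMap_matrix_apply]
  | hz => simp [ofPol_z, readDz, z, lift_proj, genMap, sigma, twist_z]
  | hzs => simp [ofPol_zs, readDz, zs, lift_proj, genMap, sigma, twist_zs]
  | hadd a b ha hb => simp [ha, hb]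
  | hmul a b ha hb => simp [ha, hb]

theorem readDzs_ofPol (f : Pol q) : readDzs q (ofPol q f) = !![f, 0; 0, sigma q f] := by
  induction f using Pol.induction with
  | hc r => ext i j; fin_cases i <;> fin_cases j <;> simp [Matrix.algebraMap_matrix_apply]
  | hz => simp [ofPol_z, readDzs, z, lift_proj, genMap, sigma, twist_z]
  | hzs => simp [ofPol_zs, readDzs, zs, lift_proj, genMap, sigma, twist_zs]
  | hadd a b ha hb => simp [ha, hb]
  | hmul a b ha hb => simp [ha, hb]

theorem readDz_form (a b : Pol q) :
    readDz q (ofPol q a * dz q + ofPol q b * dzs q) 0 1 = a := by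
  have h1 : readDz q (dz q) = !![0, 1; 0, 0] := lift_proj _ FormGen.dz
  have h2 : readDz q (dzs q) = 0 := lift_proj _ FormGen.dzs
  simp [readDz_ofPol, h1, h2]

theorem readDzs_form (a b : Pol q) :
    readDzs q (ofPol q a * dz q + ofPol q b * dzs q) 0 1 = b := by
  have h1 : readDzs q (dz q) = 0 := lift_proj _ FormGen.dz
  have h2 : readDzs q (dzs q) = !![0, 1; 0, 0] := lift_proj _ FormGen.dzs
  simp [readDzs_ofPol, h1, h2]

/-- The right partial derivatives are well defined. -/
theorem existsUnique_right (q : Param) :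
    ∃! D : (Pol q →ₗ[ℂ] Pol q) × (Pol q →ₗ[ℂ] Pol q), ∀ f : Pol q,
      d q (ofPol q f) = ofPol q (D.1 f) * dz q + ofPol q (D.2 f) * dzs q := by
  refine ⟨⟨⟨⟨fun f => readDz q (d q (ofPol q f)) 0 1, by simp⟩, by simp⟩,
    ⟨⟨fun f => readDzs q (d q (ofPol q f)) 0 1, by simp⟩, by simp⟩⟩, fun f => ?_,
    fun D hD => ?_⟩
  · obtain ⟨a, b, h⟩ := exists_d_eq f
    simp only [LinearMap.coe_mk, AddHom.coe_mk]
    rw [h, readDz_form, readDzs_form]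
  · refine Prod.ext (LinearMap.ext fun f => ?_) (LinearMap.ext fun f => ?_)
    · simp only [LinearMap.coe_mk, AddHom.coe_mk]
      rw [hD f, readDz_form]
    · simp only [LinearMap.coe_mk, AddHom.coe_mk]
      rw [hD f, readDzs_form]

/-- The left partial derivatives are well defined. -/
theorem existsUnique_left (q : Param) :
    ∃! D : (Pol q →ₗ[ℂ] Pol q) × (Pol q →ₗ[ℂ] Pol q), ∀ f : Pol q,
      d q (ofPol q f) = dz q * ofPol q (D.1 f) + dzs q * ofPol q (D.2 f) := by
  obtain ⟨D, hD, hu⟩ := existsUnique_right q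
  refine ⟨⟨(sigmaInv q).toLinearMap ∘ₗ D.1, (sigmaInv q).toLinearMap ∘ₗ D.2⟩, fun f => ?_,
    fun E hE => ?_⟩
  · simpa [dz_mul, dzs_mul, sigma_sigmaInv] using hD f
  · have := hu ⟨(sigma q).toLinearMap ∘ₗ E.1, (sigma q).toLinearMap ∘ₗ E.2⟩ fun f => by
      simpa [dz_mul, dzs_mul] using hE f
    subst this
    refine Prod.ext (LinearMap.ext fun f => ?_) (LinearMap.ext fun f => ?_) <;>
      simp [sigmaInv_sigma]

end Form

/-- The right derivative `∂^(r)/∂z^*`: `df = (∂^(r)f/∂z) dz + (∂^(r)f/∂z^*) dz^*`. -/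
def rightZs (q : Param) : Pol q →ₗ[ℂ] Pol q := (Form.existsUnique_right q).choose.2

/-- The left derivative `∂^(l)/∂z`: `df = dz (∂^(l)f/∂z) + dz^* (∂^(l)f/∂z^*)`. -/
def leftZ (q : Param) : Pol q →ₗ[ℂ] Pol q := (Form.existsUnique_left q).choose.1

/-! ### The right-hand side of the formula -/

/-- The operator `f ⊗ g ↦ f z^{*k} ⊗ z^k g` on `Pol(ℂ)_q ⊗ Pol(ℂ)_q`. -/
def innerMul (q : Param) (k : ℕ) : Module.End ℂ (Pol q ⊗[ℂ] Pol q) :=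
  TensorProduct.map (LinearMap.mulRight ℂ (Pol.zs q ^ k)) (LinearMap.mulLeft ℂ (Pol.z q ^ k))

/-- The operator `q⁻²(1 - (1 + q⁻²) z^* ⊗ z + q⁻² z^{*2} ⊗ z²) · ∂^(r)/∂z^* ⊗ ∂^(l)/∂z`. As in
every `q`-bidifferential operator, `z^*` and `z` stand between the two derivatives. -/
def box (q : Param) : Module.End ℂ (Pol q ⊗[ℂ] Pol q) :=
  (q.c ^ 2)⁻¹ • ((1 - (1 + (q.c ^ 2)⁻¹) • innerMul q 1 + (q.c ^ 2)⁻¹ • innerMul q 2) *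
    TensorProduct.map (rightZs q) (leftZ q))

/-- The polynomial `p_j`. -/
def p (q : Param) (j : ℕ) : Polynomial ℂ :=
  ∑ k ∈ Finset.range (j + 1),
    Polynomial.C (qPoch ((q.c ^ (2 * j))⁻¹) (q.c ^ 2) k / qPoch (q.c ^ 2) (q.c ^ 2) k ^ 2 *
      q.c ^ (2 * k)) *
    ∏ i ∈ Finset.range k,
      (1 - Polynomial.C (q.c ^ (2 * i)) *
          (Polynomial.C ((1 - q.c ^ 2) ^ 2) * Polynomial.X + 1 + Polynomial.C (q.c ^ 2)) +
        Polynomial.C (q.c ^ (4 * i + 2)))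

/-- The coefficient `m(p_j(□) f₁ ⊗ f₂)`, where `m` is the multiplication of `Pol(ℂ)_q`. -/
def coeffTerm (q : Param) (f₁ f₂ : Pol q) (j : ℕ) : Pol q :=
  LinearMap.mul' ℂ (Pol q) (Polynomial.aeval (box q) (p q j) (f₁ ⊗ₜ[ℂ] f₂))

/-! ### The weighted shift and the quantization -/

/-- The complex Hilbert space `ℓ²`. -/
abbrev Hil : Type := lp (fun _ : ℕ => ℂ) 2

/-- `‖e_m‖² = (q²; q²)_m / (q² t; q²)_m`. -/
def normSq (q t : Param) (m : ℕ) : ℝ :=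
  qPoch ((q : ℝ) ^ 2) ((q : ℝ) ^ 2) m / qPoch ((q : ℝ) ^ 2 * t) ((q : ℝ) ^ 2) m

theorem factor_pos (q : Param) {a : ℝ} (ha : a ≤ 1) (i : ℕ) :
    0 < 1 - ((q : ℝ) ^ 2) ^ i * ((q : ℝ) ^ 2 * a) := by
  have h0 := q.2.1
  have h1 := q.2.2
  have h2 : ((q : ℝ) ^ 2) ^ i * (q : ℝ) ^ 2 < 1 := by
    rw [← pow_succ]
    exact pow_lt_one₀ (by positivity) (pow_lt_one₀ h0.le h1 two_ne_zero) (Nat.succ_ne_zero i)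
  have h3 : 0 < ((q : ℝ) ^ 2) ^ i * (q : ℝ) ^ 2 := by positivity
  nlinarith

theorem normSq_pos (q t : Param) (m : ℕ) : 0 < normSq q t m := by
  refine div_pos (Finset.prod_pos fun i _ => ?_) (Finset.prod_pos fun i _ => ?_)
  · simpa using factor_pos q le_rfl i
  · exact factor_pos q t.2.2.le i

theorem normSq_succ_le (q t : Param) (m : ℕ) : normSq q t (m + 1) ≤ normSq q t m := by
  have h1 := factor_pos q t.2.2.le m
  have h2 := factor_pos q le_rfl m
  have h3 := normSq_pos q t m
  have h4 : 0 ≤ ((q : ℝ) ^ 2) ^ m * (q : ℝ) ^ 2 := by positivity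
  have h5 : normSq q t (m + 1) = normSq q t m *
      ((1 - ((q : ℝ) ^ 2) ^ m * (q : ℝ) ^ 2) / (1 - ((q : ℝ) ^ 2) ^ m * ((q : ℝ) ^ 2 * t))) := by
    rw [normSq, normSq, qPoch, qPoch, Finset.prod_range_succ, Finset.prod_range_succ,
      div_mul_div_comm]
    rfl
  rw [h5]
  refine mul_le_of_le_one_right h3.le ((div_le_one h1).2 ?_)
  have := t.2.2
  nlinarith

/-- The orthogonal basis `e_m`, with `‖e_m‖² = normSq q t m`. -/
def e (q t : Param) (m : ℕ) : Hil := lp.single 2 m ((√(normSq q t m) : ℝ) : ℂ)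

theorem norm_sq_e (q t : Param) (m : ℕ) : ‖e q t m‖ ^ 2 = normSq q t m := by
  rw [e, lp.norm_single (by norm_num)]
  simp [abs_of_nonneg, Real.sq_sqrt (normSq_pos q t m).le]

theorem inner_e (q t : Param) {m n : ℕ} (h : m ≠ n) : inner ℂ (e q t m) (e q t n) = 0 := by
  simp [e, lp.inner_single_left, h]

/-- The values of the shift with weights `w`. -/
def shiftFun (w : ℕ → ℝ) (f : ℕ → ℂ) : ℕ → ℂ
  | 0 => 0
  | m + 1 => w m * f m

theorem shiftFun_sq_le {w : ℕ → ℝ} (hw : ∀ m, |w m| ≤ 1) (f : ℕ → ℂ) (m : ℕ) :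
    ‖shiftFun w f (m + 1)‖ ^ (2 : ℝ) ≤ ‖f m‖ ^ (2 : ℝ) := by
  refine Real.rpow_le_rpow (norm_nonneg _) ?_ (by norm_num)
  rw [shiftFun, norm_mul, Complex.norm_real, Real.norm_eq_abs]
  exact mul_le_of_le_one_left (norm_nonneg _) (hw m)

theorem shiftFun_summable {w : ℕ → ℝ} (hw : ∀ m, |w m| ≤ 1) (f : Hil) :
    Summable fun m => ‖shiftFun w f m‖ ^ (2 : ℝ) := by
  rw [← summable_nat_add_iff 1]
  refine Summable.of_nonneg_of_le (fun m => by positivity) (shiftFun_sq_le hw f) ?_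
  simpa using (lp.memℓp f).summable (by norm_num)

/-- The weighted shift `f ↦ (0, w_0 f_0, w_1 f_1, …)` on `ℓ²`. -/
def weightedShift (w : ℕ → ℝ) (hw : ∀ m, |w m| ≤ 1) : Hil →L[ℂ] Hil :=
  LinearMap.mkContinuous
    { toFun := fun f => ⟨shiftFun w f, memℓp_gen (by simpa using shiftFun_summable hw f)⟩
      map_add' := fun f g => by
        ext m
        change shiftFun w (f + g) m = shiftFun w f m + shiftFun w g m
        cases m <;> simp [shiftFun, mul_add]
      map_smul' := fun c f => by
        ext m
        cases m <;> simp [shiftFun, mul_left_comm] }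
    1 (fun f => by
      rw [one_mul]
      refine lp.norm_le_of_tsum_le (by norm_num) (norm_nonneg f) ?_
      rw [lp.norm_rpow_eq_tsum (by norm_num) f]
      simp only [LinearMap.coe_mk, AddHom.coe_mk, ENNReal.toReal_ofNat]
      rw [(shiftFun_summable hw f).tsum_eq_zero_add]
      simp only [shiftFun, norm_zero, ne_eq, OfNat.ofNat_ne_zero, not_false_eq_true,
        Real.zero_rpow, zero_add]
      refine Summable.tsum_le_tsum (shiftFun_sq_le hw f) ?_ ?_
      · exact (summable_nat_add_iff 1).2 (shiftFun_summable hw f)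
      · simpa using (lp.memℓp f).summable (by norm_num))

theorem weight_le (q t : Param) (m : ℕ) :
    |√(normSq q t (m + 1)) / √(normSq q t m)| ≤ 1 := by
  rw [abs_of_nonneg (by positivity)]
  exact (div_le_one (Real.sqrt_pos.2 (normSq_pos q t m))).2
    (Real.sqrt_le_sqrt (normSq_succ_le q t m))

/-- The weighted shift `ẑ`, with `ẑ e_m = e_{m+1}`. -/
def zHat (q t : Param) : Hil →L[ℂ] Hil :=
  weightedShift (fun m => √(normSq q t (m + 1)) / √(normSq q t m)) (weight_le q t)

theorem zHat_e (q t : Param) (m : ℕ) : zHat q t (e q t m) = e q t (m + 1) := by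
  have h : ((√(normSq q t m) : ℝ) : ℂ) ≠ 0 := by
    exact_mod_cast (Real.sqrt_pos.2 (normSq_pos q t m)).ne'
  ext n
  change shiftFun _ (e q t m) n = _
  rcases n with _ | n
  · simp [shiftFun, e, lp.single_apply]
  · rcases eq_or_ne n m with rfl | hn
    · simp [shiftFun, e, lp.single_apply, h]
    · simp [shiftFun, e, lp.single_apply, hn]

/-- The adjoint operator `ẑ^*`. -/
def zsHat (q t : Param) : Hil →L[ℂ] Hil := ContinuousLinearMap.adjoint (zHat q t)

/-- The `q`-Berezin quantization `∑ a_ij z^i z^{*j} ↦ ∑ a_ij ẑ^i ẑ^{*j}` of polynomials. -/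
def hat (q t : Param) : Pol q →ₗ[ℂ] (Hil →L[ℂ] Hil) :=
  (Pol.basis q).constr ℂ fun ij => zHat q t ^ ij.1 * zsHat q t ^ ij.2

/-- The series `∑ a_ij z^i z^{*j}` is a covariant symbol of the operator `A`, that is,
`A = ∑ a_ij ẑ^i ẑ^{*j}` with convergence on each of the basis vectors `e_m`. -/
def HasCovariantSymbol (q t : Param) (A : Hil →L[ℂ] Hil) (a : ℕ × ℕ → ℂ) : Prop :=
  ∀ m : ℕ, HasSum (fun ij : ℕ × ℕ => a ij • (zHat q t ^ ij.1 * zsHat q t ^ ij.2) (e q t m))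
    (A (e q t m))

/-! ### The deformed product -/

/-- The formal series `F = ∑_n t^n F_n` with coefficients in `Pol(ℂ)_q` is the deformed product
of `f₁` and `f₂`: for every `t ∈ (0,1)` the coefficients of `z^i z^{*j}` in `F` converge, and they
form a covariant symbol of the operator `f̂₁ f̂₂`. -/
def IsStarProduct (q : Param) (f₁ f₂ : Pol q) (F : PowerSeries (Pol q)) : Prop :=
  ∀ t : Param, ∃ a : ℕ × ℕ → ℂ,
    (∀ ij, HasSum (fun n : ℕ => t.c ^ n * (Pol.basis q).repr (PowerSeries.coeff n F) ij) (a ij)) ∧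
    HasCovariantSymbol q t (hat q t f₁ * hat q t f₂) a

end

end QDisc

/-!
By bilinearity, and because `□` commutes with left multiplication by `z` in the first factor and
with right multiplication by `z^*` in the second, it suffices to treat `f₁ = z^{*b}` and
`f₂ = z^c`. Write `Q = q²`.

The polynomials `p_j` satisfy a three-term recurrence (`affineVar_mul_p`). For the generating
series `S(v) = (1 - t) ∑_j t^j m(p_j(□) v)` it becomes a `q`-difference equation in `t`,
`t (1 - Q)² S(□ v)(t) = (1 - t) (1 - Q t) (S(v)(t) - S(v)(Q t))` (`boxSeries_box`), which together
with `S(v)(0) = m(v)` determines `S` (`eq_zero_of_qdiff`). On the vectors `z^{*b} ⊗ z^c` the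
operator `□` is tridiagonal (`box_zs_pow_tmul_z_pow`).

On the other side, put `w_k = (Q t; Q)_k / (Q; Q)_k = 1 / ‖e_k‖²`. Comparing matrix elements, the
coefficients `a_j` of `z^{j+c-b} z^{*j}` in the symbol of `ẑ^{*b} ẑ^c` are characterized by the
convolution equation `∑_{j ≤ m} a_j w_{m-j} = w_{m+c-b} w_m / w_{m+c}`. In generating series in an
auxiliary variable `u` this is division by `w(u) = ∑ w_k u^k`, and replacing `t` by `Q t` divides
`w(u)` by `1 - Q t u` (`wGen_eq`). Hence the `q`-difference equation for the `a_j` reduces to one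
for the products `w_{m+c-b} w_m / w_{m+c}`, which is a polynomial identity
(`shiftSer_succ_qdiff`). At `t = 0` the symbol is the normally ordered form of `z^{*b} z^c`, since
the quantization at `t = 0` is a faithful representation of `Pol(ℂ)_q`
(`constantCoeff_symbolCoeff`). So both families agree (`boxSeries_eq_symbolCoeff`). The series `a_j`
converge for `|t| < 1` because the `w_k` are polynomials with `w_0 = 1` and the `1 / w_k` have their
poles outside the unit disc.

Uniqueness holds because a covariant symbol is determined by its operator, through a triangular
system (`HasCovariantSymbol.unique`), and a power series is determined by its sum on `(0,1)`.
-/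

namespace QDisc

/-! ### The three-term recurrence of the polynomials `p_j` -/

open Polynomial in
/-- The argument `(1 - Q)² X + 1 + Q` in which the polynomials `p_j` are naturally expressed. -/
noncomputable def affineVar (Q : ℂ) : ℂ[X] := C ((1 - Q) ^ 2) * X + 1 + C Q

open Polynomial in
/-- The product `∏_{i<k} (1 - Q^i Y + Q^(2i+1))`, where `Y` is `affineVar Q`. For `Y = x + Q / x` it
is `(x; Q)_k (Q / x; Q)_k`. -/
noncomputable def phi (Q : ℂ) (k : ℕ) : ℂ[X] :=
  ∏ i ∈ Finset.range k, (1 - C (Q ^ i) * affineVar Q + C (Q ^ (2 * i + 1)))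

/-- The coefficient of `phi Q k` in `p_j`. -/
noncomputable def pCoeff (Q : ℂ) (j k : ℕ) : ℂ :=
  qPoch ((Q ^ j)⁻¹) Q k / qPoch Q Q k ^ 2 * Q ^ k

theorem pCoeff_zero (Q : ℂ) (j : ℕ) : pCoeff Q j 0 = 1 := by simp [pCoeff, qPoch]

theorem qPoch_succ {K : Type*} [CommRing K] (a Q : K) (m : ℕ) :
    qPoch a Q (m + 1) = qPoch a Q m * (1 - Q ^ m * a) := Finset.prod_range_succ _ _

theorem qPoch_succ' {K : Type*} [CommRing K] (a Q : K) (m : ℕ) :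
    qPoch a Q (m + 1) = (1 - a) * qPoch (Q * a) Q m := by
  rw [qPoch, Finset.prod_range_succ', mul_comm]
  simp [qPoch, pow_succ, mul_assoc]

theorem qPoch_self_ne_zero {Q : ℂ} (h1 : ∀ n, Q ^ (n + 1) ≠ 1) (k : ℕ) : qPoch Q Q k ≠ 0 := by
  refine Finset.prod_ne_zero_iff.2 fun i _ => ?_
  rw [← pow_succ, sub_ne_zero]
  exact (h1 i).symm

theorem pCoeff_eq_zero {Q : ℂ} (h0 : Q ≠ 0) {j k : ℕ} (h : j < k) : pCoeff Q j k = 0 := by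
  have : qPoch ((Q ^ j)⁻¹) Q k = 0 := by
    refine Finset.prod_eq_zero (Finset.mem_range.2 h) ?_
    rw [mul_inv_cancel₀ (pow_ne_zero _ h0), sub_self]
  simp [pCoeff, this]

theorem p_eq (q : Param) {j M : ℕ} (h : j < M) :
    p q j = ∑ k ∈ Finset.range M, Polynomial.C (pCoeff (q.c ^ 2) j k) * phi (q.c ^ 2) k := by
  have h0 : q.c ^ 2 ≠ 0 := pow_ne_zero 2 q.c_ne_zero
  rw [← Finset.sum_subset (Finset.range_mono (Nat.succ_le_of_lt h))]
  · refine Finset.sum_congr rfl fun k _ => ?_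
    simp only [pCoeff, phi, affineVar, ← pow_mul]
    congr 1
    refine Finset.prod_congr rfl fun i _ => ?_
    rw [show 2 * (2 * i + 1) = 4 * i + 2 by ring]
  · intro k _ hk
    rw [pCoeff_eq_zero h0 (by simpa using hk)]
    simp

theorem pCoeff_recurrence {Q : ℂ} (h0 : Q ≠ 0) (h1 : ∀ n, Q ^ (n + 1) ≠ 1) (j k : ℕ) :
    (Q ^ (k + 1))⁻¹ * (1 + Q ^ (2 * (k + 1) + 1)) * pCoeff Q j (k + 1) -
        (Q ^ k)⁻¹ * pCoeff Q j k =
      (1 - Q ^ (j + 1)) * pCoeff Q (j + 1) (k + 1) + 2 * Q ^ (j + 1) * pCoeff Q j (k + 1) +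
        Q * (1 - Q ^ j) * pCoeff Q (j - 1) (k + 1) := by
  have hk : 1 - Q ^ (k + 1) ≠ 0 := sub_ne_zero.2 (h1 k).symm
  have hP := qPoch_self_ne_zero h1 k
  have e1 : qPoch ((Q ^ (j + 1))⁻¹) Q (k + 1) =
      (1 - (Q ^ (j + 1))⁻¹) * qPoch ((Q ^ j)⁻¹) Q k := by
    rw [qPoch_succ', pow_succ' Q j, mul_inv, mul_inv_cancel_left₀ h0]
  have e2 : (1 - Q ^ j) * qPoch ((Q ^ (j - 1))⁻¹) Q (k + 1) =
      -Q ^ j * (qPoch ((Q ^ j)⁻¹) Q k * (1 - Q ^ k * (Q ^ j)⁻¹) *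
        (1 - Q ^ (k + 1) * (Q ^ j)⁻¹)) := by
    rw [← qPoch_succ, ← qPoch_succ]
    rcases j with _ | j
    · simp [qPoch_succ']
    · rw [qPoch_succ' _ _ (k + 1)]
      have hj : Q ^ (j + 1) * (Q ^ (j + 1))⁻¹ = 1 := mul_inv_cancel₀ (pow_ne_zero _ h0)
      have : Q * (Q ^ (j + 1))⁻¹ = (Q ^ j)⁻¹ := by
        rw [pow_succ' Q j, mul_inv, mul_inv_cancel_left₀ h0]
      rw [this, Nat.add_sub_cancel]
      linear_combination (-qPoch (Q ^ j)⁻¹ Q (k + 1)) * hj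
  have e3 : Q * (1 - Q ^ j) * pCoeff Q (j - 1) (k + 1) =
      Q * (-Q ^ j * (qPoch ((Q ^ j)⁻¹) Q k * (1 - Q ^ k * (Q ^ j)⁻¹) *
        (1 - Q ^ (k + 1) * (Q ^ j)⁻¹))) / qPoch Q Q (k + 1) ^ 2 * Q ^ (k + 1) := by
    rw [← e2, pCoeff]
    ring
  rw [e3, pCoeff, pCoeff, pCoeff, e1, qPoch_succ, qPoch_succ, ← pow_succ]
  generalize qPoch ((Q ^ j)⁻¹) Q k = a
  have hj := pow_ne_zero j h0
  have hk' := pow_ne_zero k h0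
  rw [show 2 * (k + 1) + 1 = k + k + 3 by ring]
  simp only [pow_add, pow_one] at *
  generalize Q ^ j = J at *
  generalize Q ^ k = K at *
  field_simp
  ring

open Polynomial in
theorem affineVar_mul_phi {Q : ℂ} (h0 : Q ≠ 0) (k : ℕ) :
    affineVar Q * phi Q k =
      C ((Q ^ k)⁻¹ * (1 + Q ^ (2 * k + 1))) * phi Q k - C (Q ^ k)⁻¹ * phi Q (k + 1) := by
  have h : C (Q ^ k)⁻¹ * C (Q ^ k) = 1 := by
    rw [← C_mul, inv_mul_cancel₀ (pow_ne_zero k h0), C_1]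
  rw [phi, phi, Finset.prod_range_succ]
  simp only [C_mul, C_add, C_1]
  linear_combination (-affineVar Q *
    ∏ i ∈ Finset.range k, (1 - C (Q ^ i) * affineVar Q + C (Q ^ (2 * i + 1)))) * h

open Polynomial in
/-- The three-term recurrence of the polynomials `p_j`, which are Al-Salam–Chihara polynomials. -/
theorem affineVar_mul_p (q : Param) (h1 : ∀ n, (q.c ^ 2) ^ (n + 1) ≠ 1) (j : ℕ) :
    affineVar (q.c ^ 2) * p q j =
      C (1 - (q.c ^ 2) ^ (j + 1)) * p q (j + 1) + C (2 * (q.c ^ 2) ^ (j + 1)) * p q j +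
        C (q.c ^ 2 * (1 - (q.c ^ 2) ^ j)) * p q (j - 1) := by
  have h0 : q.c ^ 2 ≠ 0 := pow_ne_zero 2 q.c_ne_zero
  have hL : affineVar (q.c ^ 2) * p q j =
      ∑ k ∈ Finset.range (j + 3), C (((q.c ^ 2) ^ k)⁻¹ * (1 + (q.c ^ 2) ^ (2 * k + 1)) *
          pCoeff (q.c ^ 2) j k) * phi (q.c ^ 2) k -
        ∑ k ∈ Finset.range (j + 2), C (((q.c ^ 2) ^ k)⁻¹ * pCoeff (q.c ^ 2) j k) *
          phi (q.c ^ 2) (k + 1) := by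
    rw [Finset.sum_range_succ, pCoeff_eq_zero h0 (show j < j + 2 by omega)]
    simp only [mul_zero, C_0, zero_mul, add_zero]
    rw [p_eq q (show j < j + 2 by omega), Finset.mul_sum, ← Finset.sum_sub_distrib]
    refine Finset.sum_congr rfl fun k _ => ?_
    rw [mul_left_comm, affineVar_mul_phi h0]
    simp only [C_mul]
    ring
  rw [hL, p_eq q (show j + 1 < j + 3 by omega), p_eq q (show j < j + 3 by omega),
    p_eq q (show j - 1 < j + 3 by omega)]
  simp only [Finset.mul_sum, ← Finset.sum_add_distrib]
  rw [Finset.sum_range_succ', Finset.sum_range_succ' _ (j + 2), add_sub_right_comm,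
    ← Finset.sum_sub_distrib]
  congr 1
  · refine Finset.sum_congr rfl fun k _ => ?_
    rw [← sub_mul, ← C_sub, pCoeff_recurrence h0 h1]
    simp only [C_mul, C_add]
    ring
  · simp only [pCoeff_zero, phi, Finset.range_zero, Finset.prod_empty, mul_one]
    rw [C_1, mul_one, mul_one, mul_one, ← C_add, ← C_add]
    congr 1
    ring

/-! ### The partial derivatives and the operator `□` on monomials -/

theorem rightZs_eq {q : Param} (f : Pol q) :
    rightZs q f = Form.readDzs q (Form.d q (Form.ofPol q f)) 0 1 := by
  rw [(Form.existsUnique_right q).choose_spec.1 f, Form.readDzs_form]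
  rfl

theorem sigma_leftZ {q : Param} (f : Pol q) :
    Form.sigma q (leftZ q f) = Form.readDz q (Form.d q (Form.ofPol q f)) 0 1 := by
  rw [(Form.existsUnique_left q).choose_spec.1 f, Form.dz_mul, Form.dzs_mul, Form.readDz_form]
  rfl

theorem rightZs_mul {q : Param} (f g : Pol q) :
    rightZs q (f * g) = f * rightZs q g + rightZs q f * Form.sigma q g := by
  simp only [rightZs_eq]
  rw [map_mul, Form.d_mul, Form.parity_ofPol]
  rw [map_add, map_mul, map_mul, Form.readDzs_ofPol, Form.readDzs_ofPol, Matrix.add_apply,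
    Matrix.mul_apply, Matrix.mul_apply]
  simp [Fin.sum_univ_two, add_comm]

theorem leftZ_mul {q : Param} (f g : Pol q) :
    leftZ q (f * g) = Form.sigmaInv q f * leftZ q g + leftZ q f * g := by
  have h : Form.sigma q (leftZ q (f * g)) =
      f * Form.sigma q (leftZ q g) + Form.sigma q (leftZ q f) * Form.sigma q g := by
    simp only [sigma_leftZ]
    rw [map_mul, Form.d_mul, Form.parity_ofPol]
    rw [map_add, map_mul, map_mul, Form.readDz_ofPol, Form.readDz_ofPol, Matrix.add_apply,
      Matrix.mul_apply, Matrix.mul_apply]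
    simp [Fin.sum_univ_two, add_comm]
  have h' := congrArg (Form.sigmaInv q) h
  simpa [Form.sigmaInv_sigma] using h'

theorem rightZs_one {q : Param} : rightZs q (1 : Pol q) = 0 := by
  have := rightZs_mul (1 : Pol q) 1
  simpa using this

theorem leftZ_one {q : Param} : leftZ q (1 : Pol q) = 0 := by
  have := leftZ_mul (1 : Pol q) 1
  simpa using this

theorem rightZs_z {q : Param} : rightZs q (Pol.z q) = 0 := by
  rw [rightZs_eq, Form.ofPol_z, Form.d_z]
  simpa using Form.readDzs_form (q := q) 1 0

theorem rightZs_zs {q : Param} : rightZs q (Pol.zs q) = 1 := by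
  rw [rightZs_eq, Form.ofPol_zs, Form.d_zs]
  simpa using Form.readDzs_form (q := q) 0 1

theorem leftZ_z {q : Param} : leftZ q (Pol.z q) = 1 := by
  have h : Form.sigma q (leftZ q (Pol.z q)) = 1 := by
    rw [sigma_leftZ, Form.ofPol_z, Form.d_z]
    simpa using Form.readDz_form (q := q) 1 0
  simpa [Form.sigmaInv_sigma] using congrArg (Form.sigmaInv q) h

theorem leftZ_zs {q : Param} : leftZ q (Pol.zs q) = 0 := by
  have h : Form.sigma q (leftZ q (Pol.zs q)) = 0 := by
    rw [sigma_leftZ, Form.ofPol_zs, Form.d_zs]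
    simpa using Form.readDz_form (q := q) 0 1
  simpa [Form.sigmaInv_sigma] using congrArg (Form.sigmaInv q) h

theorem rightZs_zs_pow {q : Param} (b : ℕ) :
    rightZs q (Pol.zs q ^ b) =
      (∑ i ∈ Finset.range b, (q.c ^ 2)⁻¹ ^ i) • Pol.zs q ^ (b - 1) := by
  induction b with
  | zero => simp [rightZs_one]
  | succ b ih =>
    rw [pow_succ, rightZs_mul, rightZs_zs, ih, Form.sigma, Form.twist_zs, geom_sum_succ]
    rcases b with _ | b
    · simp
    · simp only [Nat.add_sub_cancel, mul_one, smul_mul_smul_comm, ← pow_succ]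
      module

theorem leftZ_z_pow {q : Param} (c : ℕ) :
    leftZ q (Pol.z q ^ c) = (∑ i ∈ Finset.range c, (q.c ^ 2)⁻¹ ^ i) • Pol.z q ^ (c - 1) := by
  induction c with
  | zero => simp [leftZ_one]
  | succ c ih =>
    rw [pow_succ', leftZ_mul, leftZ_z, ih, Form.sigmaInv, Form.twist_z, geom_sum_succ]
    rcases c with _ | c
    · simp
    · simp only [Nat.add_sub_cancel, one_mul, smul_mul_smul_comm, ← pow_succ']
      module

theorem rightZs_z_pow_mul {q : Param} (a : ℕ) (f : Pol q) :
    rightZs q (Pol.z q ^ a * f) = Pol.z q ^ a * rightZs q f := by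
  induction a with
  | zero => simp
  | succ a ih =>
    rw [pow_succ', mul_assoc, rightZs_mul, ih, rightZs_z, zero_mul, add_zero, mul_assoc]

theorem leftZ_mul_zs_pow {q : Param} (f : Pol q) (d : ℕ) :
    leftZ q (f * Pol.zs q ^ d) = leftZ q f * Pol.zs q ^ d := by
  induction d with
  | zero => simp
  | succ d ih =>
    rw [pow_succ, ← mul_assoc, leftZ_mul, ih, leftZ_zs, mul_zero, zero_add, mul_assoc]

theorem box_tmul {q : Param} (f g : Pol q) :
    box q (f ⊗ₜ[ℂ] g) = (q.c ^ 2)⁻¹ • (rightZs q f ⊗ₜ leftZ q g -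
      (1 + (q.c ^ 2)⁻¹) • (rightZs q f * Pol.zs q ^ 1) ⊗ₜ[ℂ] (Pol.z q ^ 1 * leftZ q g) +
      (q.c ^ 2)⁻¹ • (rightZs q f * Pol.zs q ^ 2) ⊗ₜ[ℂ] (Pol.z q ^ 2 * leftZ q g)) := rfl

/-- The scalar `[b] [c] / Q` that `□` produces on `z^{*b} ⊗ z^c`, with the
`q`-numbers `[n]` in base `1 / Q`. -/
noncomputable def boxFactor (Q : ℂ) (b c : ℕ) : ℂ :=
  Q⁻¹ * (∑ i ∈ Finset.range b, Q⁻¹ ^ i) * ∑ i ∈ Finset.range c, Q⁻¹ ^ i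

theorem sq_mul_boxFactor {Q : ℂ} (h0 : Q ≠ 0) (b c : ℕ) :
    (1 - Q) ^ 2 * boxFactor Q b c = Q * (1 - Q⁻¹ ^ b) * (1 - Q⁻¹ ^ c) := by
  rw [← mul_neg_geom_sum, ← mul_neg_geom_sum, boxFactor]
  field_simp
  ring

theorem box_zs_pow_tmul_z_pow {q : Param} (b c : ℕ) :
    box q ((Pol.zs q ^ b) ⊗ₜ[ℂ] (Pol.z q ^ c)) = boxFactor (q.c ^ 2) b c •
      ((Pol.zs q ^ (b - 1)) ⊗ₜ (Pol.z q ^ (c - 1)) -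
        (1 + (q.c ^ 2)⁻¹) • (Pol.zs q ^ b) ⊗ₜ[ℂ] (Pol.z q ^ c) +
        (q.c ^ 2)⁻¹ • (Pol.zs q ^ (b + 1)) ⊗ₜ[ℂ] (Pol.z q ^ (c + 1))) := by
  rw [box_tmul, rightZs_zs_pow, leftZ_z_pow, boxFactor]
  rcases b with _ | b
  · simp
  rcases c with _ | c
  · simp
  simp only [Nat.add_sub_cancel, smul_mul_assoc, mul_smul_comm, ← pow_add,
    TensorProduct.smul_tmul_smul, add_comm 1 c, add_comm 2 c]
  module

/-- `f ⊗ g ↦ z^a f ⊗ g z^{*d}`. -/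
noncomputable def outerMul (q : Param) (a d : ℕ) : Module.End ℂ (Pol q ⊗[ℂ] Pol q) :=
  TensorProduct.map (LinearMap.mulLeft ℂ (Pol.z q ^ a)) (LinearMap.mulRight ℂ (Pol.zs q ^ d))

theorem commute_box_outerMul (q : Param) (a d : ℕ) : Commute (box q) (outerMul q a d) := by
  refine TensorProduct.ext' fun f g => ?_
  change box q ((Pol.z q ^ a * f) ⊗ₜ (g * Pol.zs q ^ d)) = outerMul q a d (box q (f ⊗ₜ g))
  rw [box_tmul, box_tmul, rightZs_z_pow_mul, leftZ_mul_zs_pow]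
  simp [outerMul, mul_assoc]

theorem coeffTerm_z_pow_mul_mul_zs_pow {q : Param} (a d : ℕ) (f g : Pol q) (j : ℕ) :
    coeffTerm q (Pol.z q ^ a * f) (g * Pol.zs q ^ d) j =
      Pol.z q ^ a * coeffTerm q f g j * Pol.zs q ^ d := by
  have h : Commute (Polynomial.aeval (box q) (p q j)) (outerMul q a d) := by
    rw [Polynomial.aeval_eq_sum_range]
    exact Commute.sum_left _ _ _ fun i _ => ((commute_box_outerMul q a d).pow_left i).smul_left _
  have h2 : LinearMap.mul' ℂ (Pol q) ∘ₗ outerMul q a d =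
      LinearMap.mulRight ℂ (Pol.zs q ^ d) ∘ₗ LinearMap.mulLeft ℂ (Pol.z q ^ a) ∘ₗ
        LinearMap.mul' ℂ (Pol q) := by
    refine TensorProduct.ext' fun f g => ?_
    simp [outerMul, mul_assoc]
  have h3 := LinearMap.congr_fun h.eq (f ⊗ₜ g)
  change LinearMap.mul' ℂ (Pol q) ((Polynomial.aeval (box q) (p q j) * outerMul q a d) (f ⊗ₜ g)) = _
  rw [h3]
  exact LinearMap.congr_fun h2 _

/-! ### The `q`-difference equation in `t` -/

open PowerSeries

/-- The coordinate `ℓ` of the series `(1 - X) ∑_j X^j m(p_j(□) v)`. -/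
noncomputable def boxSeries (q : Param) (ℓ : Pol q →ₗ[ℂ] ℂ) :
    Pol q ⊗[ℂ] Pol q →ₗ[ℂ] ℂ⟦X⟧ where
  toFun v := (1 - X) * mk fun j =>
    ℓ (LinearMap.mul' ℂ (Pol q) (Polynomial.aeval (box q) (p q j) v))
  map_add' v w := by
    rw [← mul_add]
    congr 1
    ext
    simp
  map_smul' c v := by
    rw [RingHom.id_apply, ← mul_smul_comm]
    congr 1
    ext
    simp

theorem coeff_boxSeries {q : Param} (ℓ : Pol q →ₗ[ℂ] ℂ) (f g : Pol q) (n : ℕ) :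
    coeff n (boxSeries q ℓ (f ⊗ₜ g)) =
      ℓ (coeff n ((1 - X) * mk fun j => coeffTerm q f g j)) := by
  simp only [boxSeries, LinearMap.coe_mk, AddHom.coe_mk, sub_mul, one_mul, map_sub, coeff_mk]
  rcases n with _ | n
  · simp [coeffTerm]
  · simp [coeff_succ_X_mul, coeffTerm]

theorem p_zero (q : Param) : p q 0 = 1 := by simp [p, qPoch]

theorem constantCoeff_boxSeries {q : Param} (ℓ : Pol q →ₗ[ℂ] ℂ) (f g : Pol q) :
    constantCoeff (boxSeries q ℓ (f ⊗ₜ g)) = ℓ (f * g) := by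
  simp only [boxSeries, LinearMap.coe_mk, AddHom.coe_mk]
  rw [map_mul, ← coeff_zero_eq_constantCoeff_apply (mk _), coeff_mk]
  simp [p_zero]

/-- The generating function of the three-term recurrence: the operator `□` acts on
`(1 - X) ∑_j X^j p_j(□)` as a `q`-difference operator in the deformation parameter. -/
theorem boxSeries_box {q : Param} (h1 : ∀ n, (q.c ^ 2) ^ (n + 1) ≠ 1) (ℓ : Pol q →ₗ[ℂ] ℂ)
    (v : Pol q ⊗[ℂ] Pol q) :
    X * (((1 - q.c ^ 2) ^ 2) • boxSeries q ℓ (box q v)) =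
      (1 - X) * (1 - C (q.c ^ 2) * X) *
        (boxSeries q ℓ v - rescale (q.c ^ 2) (boxSeries q ℓ v)) := by
  set Q := q.c ^ 2 with hQ
  let H : Pol q ⊗[ℂ] Pol q → ℂ⟦X⟧ := fun v => mk fun j =>
    ℓ (LinearMap.mul' ℂ (Pol q) (Polynomial.aeval (box q) (p q j) v))
  have hS : ∀ v, boxSeries q ℓ v = (1 - X) * H v := fun v => rfl
  have hrec : ∀ j, (1 - Q) ^ 2 * coeff j (H (box q v)) + (1 + Q) * coeff j (H v) =
      (1 - Q ^ (j + 1)) * coeff (j + 1) (H v) + 2 * Q ^ (j + 1) * coeff j (H v) +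
        Q * (1 - Q ^ j) * coeff (j - 1) (H v) := by
    intro j
    have h := congrArg (fun P => ℓ (LinearMap.mul' ℂ (Pol q)
      (Polynomial.aeval (box q) P v))) (affineVar_mul_p q h1 j)
    rw [mul_comm (affineVar _)] at h
    simp only [affineVar, mul_add, mul_one, map_add, map_mul, Polynomial.aeval_C,
      Polynomial.aeval_X, Module.End.mul_apply, LinearMap.add_apply,
      Module.algebraMap_end_apply, map_smul, smul_eq_mul] at h
    simp only [H, coeff_mk, hQ]
    linear_combination h
  have hH : X * ((1 - Q) ^ 2 • H (box q v)) =
      (1 - X) * (1 - C Q * X) * H v - (1 - C Q * X) ^ 2 * rescale Q (H v) := by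
    have e : (1 - X) * (1 - C Q * X) * H v - (1 - C Q * X) ^ 2 * rescale Q (H v) =
        H v - rescale Q (H v) + X * (C (2 * Q) * rescale Q (H v) - H v - C Q * H v +
          X * (C Q * H v - C (Q ^ 2) * rescale Q (H v))) := by
      simp only [map_mul, map_pow, map_ofNat]
      ring
    rw [e]
    ext n
    rcases n with _ | n
    · rw [map_add, map_sub, coeff_zero_X_mul, coeff_zero_X_mul, coeff_rescale]
      simp
    · have := hrec n
      rcases n with _ | n
      · simp only [map_add, map_sub, coeff_succ_X_mul, coeff_C_mul, coeff_rescale, coeff_smul,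
          smul_eq_mul, coeff_zero_X_mul]
        linear_combination this
      · simp only [map_add, map_sub, coeff_succ_X_mul, coeff_C_mul, coeff_rescale, coeff_smul,
          smul_eq_mul]
        rw [Nat.add_sub_cancel] at this
        linear_combination this
  rw [hS, hS, map_mul, map_sub, map_one, rescale_X]
  rw [← mul_smul_comm, mul_left_comm, hH]
  ring

/-! ### Coefficients of the deformed product as formal power series in `t` -/

/-- The formal power series `1 / ‖e_k‖² = (Q t; Q)_k / (Q; Q)_k` in the variable `t = X`. -/
noncomputable def wSer (Q : ℂ) (k : ℕ) : ℂ⟦X⟧ :=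
  C (qPoch Q Q k)⁻¹ * ∏ i ∈ Finset.range k, (1 - C (Q ^ (i + 1)) * X)

/-- The formal power series `‖e_k‖² = (Q; Q)_k / (Q t; Q)_k` in the variable `t = X`, with its
denominators expanded as geometric series. -/
noncomputable def wInv (Q : ℂ) (k : ℕ) : ℂ⟦X⟧ :=
  C (qPoch Q Q k) * ∏ i ∈ Finset.range k, mk fun n => (Q ^ (i + 1)) ^ n

theorem one_sub_mul_mk_pow (a : ℂ) : (1 - C a * X) * (mk fun n => a ^ n) = 1 := by
  ext n
  rw [sub_mul, one_mul, map_sub, mul_assoc, coeff_C_mul]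
  rcases n with _ | n
  · simp
  · rw [coeff_succ_X_mul, coeff_mk, coeff_mk, coeff_one]
    simp [pow_succ']

theorem one_sub_C_mul_X_ne_zero (a : ℂ) : (1 - C a * X : ℂ⟦X⟧) ≠ 0 := fun h => by
  have := one_sub_mul_mk_pow a
  simp [h] at this

theorem wSer_zero (Q : ℂ) : wSer Q 0 = 1 := by simp [wSer, qPoch]

theorem wSer_mul_wInv {Q : ℂ} (h1 : ∀ n, Q ^ (n + 1) ≠ 1) (k : ℕ) : wSer Q k * wInv Q k = 1 := by
  rw [wSer, wInv, mul_mul_mul_comm, ← map_mul, inv_mul_cancel₀ (qPoch_self_ne_zero h1 k), map_one,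
    ← Finset.prod_mul_distrib, one_mul]
  exact Finset.prod_eq_one fun i _ => one_sub_mul_mk_pow _

theorem wSer_succ {Q : ℂ} (h1 : ∀ n, Q ^ (n + 1) ≠ 1) (k : ℕ) :
    C (1 - Q ^ (k + 1)) * wSer Q (k + 1) = (1 - C (Q ^ (k + 1)) * X) * wSer Q k := by
  have h : (1 - Q ^ (k + 1)) * (qPoch Q Q (k + 1))⁻¹ = (qPoch Q Q k)⁻¹ := by
    have := sub_ne_zero.2 (h1 k).symm
    rw [qPoch_succ, ← pow_succ]
    field_simp
  rw [wSer, wSer, Finset.prod_range_succ, ← mul_assoc, ← map_mul, h]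
  ring

theorem wInv_succ (Q : ℂ) (k : ℕ) :
    (1 - C (Q ^ (k + 1)) * X) * wInv Q (k + 1) = C (1 - Q ^ (k + 1)) * wInv Q k := by
  rw [wInv, wInv, Finset.prod_range_succ, qPoch_succ, ← pow_succ, map_mul]
  linear_combination (C (qPoch Q Q k) * C (1 - Q ^ (k + 1)) *
    ∏ i ∈ Finset.range k, mk fun n => (Q ^ (i + 1)) ^ n) * one_sub_mul_mk_pow (Q ^ (k + 1))

theorem rescale_C (a b : ℂ) : rescale a (C b) = C b := by
  ext n
  rw [coeff_rescale, coeff_C]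
  split_ifs with h <;> simp [h]

theorem rescale_wSer (Q : ℂ) (k : ℕ) :
    (1 - C Q * X) * rescale Q (wSer Q k) = (1 - C (Q ^ (k + 1)) * X) * wSer Q k := by
  have h := Finset.prod_range_succ' (fun i => (1 - C (Q ^ (i + 1)) * X : ℂ⟦X⟧)) k
  rw [Finset.prod_range_succ] at h
  rw [wSer, map_mul, map_prod, rescale_C]
  have h2 : ∀ i, rescale Q (1 - C (Q ^ (i + 1)) * X : ℂ⟦X⟧) = 1 - C (Q ^ (i + 1 + 1)) * X := by
    intro i
    rw [map_sub, map_one, map_mul, rescale_C, rescale_X, ← mul_assoc, ← map_mul, ← pow_succ]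
  simp only [h2]
  rw [zero_add, pow_one] at h
  linear_combination (-C (qPoch Q Q k)⁻¹) * h

theorem rescale_wInv {Q : ℂ} (h1 : ∀ n, Q ^ (n + 1) ≠ 1) (k : ℕ) :
    (1 - C (Q ^ (k + 1)) * X) * rescale Q (wInv Q k) = (1 - C Q * X) * wInv Q k := by
  have h2 := wSer_mul_wInv h1 k
  have h3 : rescale Q (wSer Q k) * rescale Q (wInv Q k) = 1 := by rw [← map_mul, h2, map_one]
  linear_combination (-(1 - C (Q ^ (k + 1)) * X) * rescale Q (wInv Q k)) * h2 +
    (1 - C Q * X) * wInv Q k * h3 - wInv Q k * rescale Q (wInv Q k) * rescale_wSer Q k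

/-- The generating series `∑_k w_k u^k` of the weights `w_k = 1 / ‖e_k‖²`. -/
noncomputable def wGen (Q : ℂ) : ℂ⟦X⟧⟦X⟧ := mk (wSer Q)

/-- The series `w_{m+c-b} w_m / w_{m+c}`, set to zero for `m + c < b`. It is `w_m` times the
coefficient of `e_{m+c-b}` in `ẑ^{*b} ẑ^c e_m`. -/
noncomputable def shiftSer (Q : ℂ) (b c m : ℕ) : ℂ⟦X⟧ :=
  if b ≤ m + c then wSer Q (m + c - b) * wSer Q m * wInv Q (m + c) else 0

/-- The generating series in `u` of the coefficients of the covariant symbol of `ẑ^{*b} ẑ^c`: the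
coefficient of `u^j` belongs to the monomial `z^{j+c-b} z^{*j}`. -/
noncomputable def symbolGen (Q : ℂ) (b c : ℕ) : ℂ⟦X⟧⟦X⟧ :=
  invOfUnit (wGen Q) 1 * mk (shiftSer Q b c)

theorem constantCoeff_wGen (Q : ℂ) : constantCoeff (wGen Q) = ((1 : ℂ⟦X⟧ˣ) : ℂ⟦X⟧) := by
  rw [← coeff_zero_eq_constantCoeff_apply, wGen, coeff_mk, wSer_zero, Units.val_one]

theorem symbolGen_mul_wGen (Q : ℂ) (b c : ℕ) :
    symbolGen Q b c * wGen Q = mk (shiftSer Q b c) := by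
  have h := mul_invOfUnit (wGen Q) 1 (constantCoeff_wGen Q)
  rw [symbolGen]
  linear_combination (mk (shiftSer Q b c)) * h

theorem shiftSer_zero_left {Q : ℂ} (h1 : ∀ n, Q ^ (n + 1) ≠ 1) (c m : ℕ) :
    shiftSer Q 0 c m = wSer Q m := by
  rw [shiftSer, if_pos (Nat.zero_le _), Nat.sub_zero]
  linear_combination (wSer Q m) * wSer_mul_wInv h1 (m + c)

theorem shiftSer_zero_right {Q : ℂ} (h1 : ∀ n, Q ^ (n + 1) ≠ 1) (b m : ℕ) :
    shiftSer Q b 0 m = if b ≤ m then wSer Q (m - b) else 0 := by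
  rw [shiftSer, Nat.add_zero]
  split_ifs
  · linear_combination (wSer Q (m - b)) * wSer_mul_wInv h1 m
  · rfl

theorem rescale_wSer_succ {Q : ℂ} (h1 : ∀ n, Q ^ (n + 1) ≠ 1) (m : ℕ) :
    rescale Q (wSer Q (m + 1)) - C Q * X * rescale Q (wSer Q m) = wSer Q (m + 1) := by
  refine mul_left_cancel₀ (one_sub_C_mul_X_ne_zero Q) ?_
  have h2 := rescale_wSer Q (m + 1)
  have h3 := rescale_wSer Q m
  have h4 := wSer_succ h1 m
  simp only [map_sub, map_one, map_pow] at h2 h3 h4 ⊢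
  linear_combination h2 - C Q * X * h3 + C Q * X * h4

theorem wGen_eq {Q : ℂ} (h1 : ∀ n, Q ^ (n + 1) ≠ 1) :
    (1 - C (C Q * X) * X) * map (rescale Q) (wGen Q) = wGen Q := by
  ext1 m
  rw [sub_mul, one_mul, map_sub, mul_assoc, coeff_C_mul]
  rcases m with _ | m
  · rw [coeff_zero_X_mul, coeff_map, wGen, coeff_mk, wSer_zero]
    simp
  · rw [coeff_succ_X_mul]
    simpa [wGen] using rescale_wSer_succ h1 m

theorem one_sub_mul_rescale_wSer_pred {Q : ℂ} (h1 : ∀ n, Q ^ (n + 1) ≠ 1) (l : ℕ) :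
    (1 - C Q * X) * rescale Q (wSer Q l) = C (1 - Q ^ (l + 1)) * wSer Q (l + 1) := by
  rw [rescale_wSer, wSer_succ h1]

/-- The `q`-difference equation of the generating series of the `shiftSer Q b c m`, at the
coefficient `u^m`, for positive exponents. -/
theorem shiftSer_succ_qdiff {Q : ℂ} (h0 : Q ≠ 0) (h1 : ∀ n, Q ^ (n + 1) ≠ 1) (b c m : ℕ) :
    X * ((Q * (1 - Q⁻¹ ^ (b + 1)) * (1 - Q⁻¹ ^ (c + 1))) •
        (shiftSer Q b c m - (1 + Q⁻¹) • shiftSer Q (b + 1) (c + 1) m +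
          Q⁻¹ • shiftSer Q (b + 2) (c + 2) m)) =
      (1 - X) * (1 - C Q * X) * (shiftSer Q (b + 1) (c + 1) m -
        rescale Q (shiftSer Q (b + 1) (c + 1) m) +
        C Q * X * rescale Q (if m = 0 then 0 else shiftSer Q (b + 1) (c + 1) (m - 1))) := by
  by_cases hb : m + c < b
  · have e1 : ∀ k, shiftSer Q (b + k) (c + k) m = 0 := fun k => if_neg (by omega)
    have e2 : shiftSer Q (b + 1) (c + 1) (m - 1) = 0 := if_neg (by omega)
    have e3 := e1 0
    simp only [add_zero] at e3
    simp [e1, e2, e3]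
  obtain ⟨l, hl⟩ := Nat.exists_eq_add_of_le (not_lt.1 hb)
  have e1 : ∀ k, shiftSer Q (b + k) (c + k) m = wSer Q l * wSer Q m * wInv Q (m + c + k) := by
    intro k
    rw [shiftSer, if_pos (by omega), show m + (c + k) - (b + k) = l by omega, add_assoc]
  have e0 := e1 0
  simp only [add_zero] at e0
  set N := m + c with hN
  -- the neighbouring coefficient; it vanishes exactly when `l = 0` or `m = 0`
  have e2 : (1 - C Q * X) ^ 2 *
      rescale Q (if m = 0 then 0 else shiftSer Q (b + 1) (c + 1) (m - 1)) =
        C (1 - Q ^ l) * C (1 - Q ^ m) * wSer Q l * wSer Q m * rescale Q (wInv Q N) := by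
    rcases m with _ | m
    · simp
    rcases l with _ | l
    · rw [if_neg (Nat.succ_ne_zero m), shiftSer, if_neg (by omega)]
      simp
    · rw [if_neg (Nat.succ_ne_zero m), shiftSer, if_pos (by omega),
        show m + 1 - 1 + (c + 1) - (b + 1) = l by omega,
        show m + 1 - 1 + (c + 1) = N by omega, map_mul, map_mul, Nat.add_sub_cancel]
      linear_combination rescale Q (wInv Q N) * (1 - C Q * X) * rescale Q (wSer Q m) *
        one_sub_mul_rescale_wSer_pred h1 l + rescale Q (wInv Q N) *
        C (1 - Q ^ (l + 1)) * wSer Q (l + 1) * one_sub_mul_rescale_wSer_pred h1 m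
  -- all inverse weights are multiples of one series `V`
  have hN1 : 1 - Q ^ (N + 1) ≠ 0 := sub_ne_zero.2 (h1 N).symm
  have hN2 : 1 - Q ^ (N + 2) ≠ 0 := sub_ne_zero.2 (h1 (N + 1)).symm
  obtain ⟨V, hV⟩ : ∃ V, wInv Q (N + 2) = C (1 - Q ^ (N + 1)) * C (1 - Q ^ (N + 2)) * V := by
    refine ⟨C (((1 - Q ^ (N + 1)) * (1 - Q ^ (N + 2)))⁻¹) * wInv Q (N + 2), ?_⟩
    rw [← map_mul, ← mul_assoc, ← map_mul, mul_inv_cancel₀ (mul_ne_zero hN1 hN2), map_one, one_mul]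
  have hC : ∀ {a : ℂ}, a ≠ 0 → (C a : ℂ⟦X⟧) ≠ 0 := fun ha h => ha (by simpa using h)
  have hV1 : wInv Q (N + 1) = C (1 - Q ^ (N + 1)) * (1 - C (Q ^ (N + 2)) * X) * V := by
    refine mul_left_cancel₀ (hC hN2) ?_
    have := wInv_succ Q (N + 1)
    rw [show N + 1 + 1 = N + 2 from rfl, hV] at this
    linear_combination -this
  have hV0 : wInv Q N = (1 - C (Q ^ (N + 1)) * X) * (1 - C (Q ^ (N + 2)) * X) * V := by
    refine mul_left_cancel₀ (hC hN1) ?_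
    have := wInv_succ Q N
    rw [hV1] at this
    linear_combination -this
  have hD1 : rescale Q (wInv Q (N + 1)) = (1 - C Q * X) * C (1 - Q ^ (N + 1)) * V := by
    refine mul_left_cancel₀ (one_sub_C_mul_X_ne_zero (Q ^ (N + 2))) ?_
    have := rescale_wInv h1 (N + 1)
    linear_combination this + (1 - C Q * X) * hV1
  have hD0 : rescale Q (wInv Q N) = (1 - C Q * X) * (1 - C (Q ^ (N + 2)) * X) * V := by
    refine mul_left_cancel₀ (one_sub_C_mul_X_ne_zero (Q ^ (N + 1))) ?_
    have := rescale_wInv h1 N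
    linear_combination this + (1 - C Q * X) * hV0
  have hDB : (1 - C Q * X) * rescale Q (wSer Q l * wSer Q m * wInv Q (N + 1)) =
      (1 - C (Q ^ (l + 1)) * X) * (1 - C (Q ^ (m + 1)) * X) * C (1 - Q ^ (N + 1)) *
        (wSer Q l * wSer Q m * V) := by
    rw [map_mul, map_mul, hD1]
    linear_combination rescale Q (wSer Q m) * (1 - C Q * X) * C (1 - Q ^ (N + 1)) * V *
      rescale_wSer Q l + (1 - C (Q ^ (l + 1)) * X) * wSer Q l * C (1 - Q ^ (N + 1)) * V *
      rescale_wSer Q m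
  have hE : (1 - C Q * X) * rescale Q (if m = 0 then 0 else shiftSer Q (b + 1) (c + 1) (m - 1)) =
      C (1 - Q ^ l) * C (1 - Q ^ m) * (1 - C (Q ^ (N + 2)) * X) *
        (wSer Q l * wSer Q m * V) := by
    refine mul_left_cancel₀ (one_sub_C_mul_X_ne_zero Q) ?_
    rw [hD0] at e2
    linear_combination e2
  have hα : (C Q : ℂ⟦X⟧) ^ l = C Q ^ (N + 1) * C Q⁻¹ ^ (b + 1) := by
    rw [show N + 1 = l + (b + 1) by omega, pow_add, mul_assoc, ← mul_pow, ← map_mul,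
      mul_inv_cancel₀ h0, map_one, one_pow, mul_one]
  have hβ : (C Q : ℂ⟦X⟧) ^ m = C Q ^ (N + 1) * C Q⁻¹ ^ (c + 1) := by
    rw [show N + 1 = m + (c + 1) by omega, pow_add, mul_assoc, ← mul_pow, ← map_mul,
      mul_inv_cancel₀ h0, map_one, one_pow, mul_one]
  have hQ : (C Q : ℂ⟦X⟧) * C Q⁻¹ = 1 := by rw [← map_mul, mul_inv_cancel₀ h0, map_one]
  refine mul_left_cancel₀ (one_sub_C_mul_X_ne_zero Q) ?_
  rw [e0, e1, e1]
  generalize rescale Q (if m = 0 then 0 else shiftSer Q (b + 1) (c + 1) (m - 1)) = E at hE ⊢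
  generalize rescale Q (wSer Q l * wSer Q m * wInv Q (N + 1)) = B at hDB ⊢
  rw [hV, hV1, hV0]
  generalize wSer Q l * wSer Q m = W at *
  simp only [smul_eq_C_mul, map_mul, map_sub, map_one, map_add, map_pow] at hDB hE ⊢
  have hpow : ∀ k : ℕ, (C Q : ℂ⟦X⟧) ^ (k + 1) = C Q * C Q ^ k := fun k => pow_succ' _ _
  rw [show N + 2 = (N + 1) + 1 from rfl, hpow (N + 1)] at *
  rw [hpow l, hpow m, hα, hβ] at hDB
  rw [hα, hβ] at hE
  generalize (C Q : ℂ⟦X⟧) ^ (N + 1) = γ at *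
  generalize (C Q⁻¹ : ℂ⟦X⟧) ^ (b + 1) = ib at *
  generalize (C Q⁻¹ : ℂ⟦X⟧) ^ (c + 1) = ic at *
  generalize (C Q : ℂ⟦X⟧) = P at *
  generalize (C Q⁻¹ : ℂ⟦X⟧) = iP at *
  linear_combination (1 - X) * (1 - P * X) * hDB - (1 - X) * (1 - P * X) * P * X * hE +
    X * (1 - ib) * (1 - ic) * (1 - P * X) * W * V *
      ((1 - γ) * (1 - P * γ) - (1 - γ) * (1 - P * γ * X)) * hQ

/-- The `q`-difference equation of the symbols of the operators `ẑ^{*b} ẑ^c`. Up to the factor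
`wGen Q`, which `wGen_eq` transforms, it is an identity between single weights. -/
theorem symbolGen_qdiff {Q : ℂ} (h0 : Q ≠ 0) (h1 : ∀ n, Q ^ (n + 1) ≠ 1) (b c : ℕ) :
    C X * (C (C (Q * (1 - Q⁻¹ ^ b) * (1 - Q⁻¹ ^ c))) *
        (symbolGen Q (b - 1) (c - 1) - C (C (1 + Q⁻¹)) * symbolGen Q b c +
          C (C Q⁻¹) * symbolGen Q (b + 1) (c + 1))) =
      C ((1 - X) * (1 - C Q * X)) *
        (symbolGen Q b c - map (rescale Q) (symbolGen Q b c)) := by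
  have hw := mul_invOfUnit (wGen Q) 1 (constantCoeff_wGen Q)
  have hw' : map (rescale Q) (wGen Q) * map (rescale Q) (invOfUnit (wGen Q) 1) = 1 := by
    rw [← map_mul, hw, map_one]
  have hD : map (rescale Q) (invOfUnit (wGen Q) 1) =
      invOfUnit (wGen Q) 1 * (1 - C (C Q * X) * X) := by
    linear_combination (-map (rescale Q) (invOfUnit (wGen Q) 1)) * hw +
      invOfUnit (wGen Q) 1 * (1 - C (C Q * X) * X) * hw' -
      invOfUnit (wGen Q) 1 * map (rescale Q) (invOfUnit (wGen Q) 1) * wGen_eq h1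
  have key : C X * (C (C (Q * (1 - Q⁻¹ ^ b) * (1 - Q⁻¹ ^ c))) *
        (mk (shiftSer Q (b - 1) (c - 1)) - C (C (1 + Q⁻¹)) * mk (shiftSer Q b c) +
          C (C Q⁻¹) * mk (shiftSer Q (b + 1) (c + 1)))) =
      C ((1 - X) * (1 - C Q * X)) *
        (mk (shiftSer Q b c) - (1 - C (C Q * X) * X) *
          map (rescale Q) (mk (shiftSer Q b c))) := by
    rcases b with _ | b
    · have : mk (shiftSer Q 0 c) = wGen Q := by ext1 m; simp [wGen, shiftSer_zero_left h1]
      rw [this, wGen_eq h1]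
      simp
    rcases c with _ | c
    · have : mk (shiftSer Q (b + 1) 0) = X ^ (b + 1) * wGen Q := by
        ext1 m
        rw [coeff_X_pow_mul', coeff_mk, shiftSer_zero_right h1, wGen, coeff_mk]
      rw [this, map_mul (map (rescale Q)), map_pow, map_X, mul_left_comm (1 - _), wGen_eq h1]
      simp
    ext1 m
    have h := shiftSer_succ_qdiff h0 h1 b c m
    simp only [smul_eq_C_mul] at h
    have e : coeff m ((1 - C (C Q * X) * X) * map (rescale Q) (mk (shiftSer Q (b + 1) (c + 1)))) =
        rescale Q (shiftSer Q (b + 1) (c + 1) m) - C Q * X *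
          rescale Q (if m = 0 then 0 else shiftSer Q (b + 1) (c + 1) (m - 1)) := by
      rw [sub_mul, one_mul, map_sub, mul_assoc, coeff_C_mul]
      rcases m with _ | m
      · rw [coeff_zero_X_mul, coeff_map, coeff_mk]
        simp
      · rw [coeff_succ_X_mul]
        simp
    generalize (1 + Q⁻¹ : ℂ) = r at h ⊢
    simp only [coeff_C_mul, map_sub, map_add, Nat.add_sub_cancel, coeff_mk] at h e ⊢
    rw [e]
    linear_combination h
  simp only [symbolGen]
  rw [map_mul (map (rescale Q)), hD]
  linear_combination (invOfUnit (wGen Q) 1) * key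

/-- A family of power series that satisfies the homogeneous `q`-difference equation and has no
constant terms vanishes. The left-hand sides `T' i` stand for linear combinations of the family, of
which only the divisibility by the common powers of `X` matters: the equation then raises the common
power dividing the family, since `1 - Q^n ≠ 0` for `n ≥ 1`. -/
theorem eq_zero_of_qdiff {Q : ℂ} (h1 : ∀ n, Q ^ (n + 1) ≠ 1) {ι : Type*} {T T' : ι → ℂ⟦X⟧}
    (hT' : ∀ n, (∀ i, X ^ n ∣ T i) → ∀ i, X ^ n ∣ T' i)
    (h : ∀ i, X * T' i = (1 - X) * (1 - C Q * X) * (T i - rescale Q (T i)))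
    (h0 : ∀ i, constantCoeff (T i) = 0) (i : ι) : T i = 0 := by
  have hd : ∀ n i, X ^ (n + 1) ∣ T i := by
    intro n
    induction n with
    | zero => intro i; rw [zero_add, pow_one]; exact X_dvd_iff.2 (h0 i)
    | succ n ih =>
      intro i
      obtain ⟨S, hS⟩ := hT' _ ih i
      have hu1 := one_sub_mul_mk_pow 1
      have hu2 := one_sub_mul_mk_pow Q
      rw [map_one, one_mul] at hu1
      have h2 : X ^ (n + 2) ∣ T i - rescale Q (T i) := by
        refine ⟨S * (mk fun n => 1 ^ n) * (mk fun n => Q ^ n), ?_⟩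
        have h3 := h i
        rw [hS] at h3
        linear_combination (-(T i - rescale Q (T i))) * hu1 - (T i - rescale Q (T i)) *
          (1 - X) * (mk fun n => 1 ^ n) * hu2 - (mk fun n => 1 ^ n) * (mk fun n => Q ^ n) * h3
      rw [X_pow_dvd_iff] at h2 ⊢
      intro k hk
      rcases k with _ | k
      · simpa using h0 i
      · have h4 := h2 _ hk
        rw [map_sub, coeff_rescale] at h4
        have h5 : (1 - Q ^ (k + 1)) * coeff (k + 1) (T i) = 0 := by linear_combination h4
        exact (mul_eq_zero.1 h5).resolve_left (sub_ne_zero.2 (h1 k).symm)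
  ext n
  exact X_pow_dvd_iff.1 (hd n i) n (Nat.lt_succ_self n)

/-! ### Evaluation of absolutely convergent power series -/

/-- The power series `P` converges absolutely at `τ`, with the sum `v`. -/
def ConvergesAt (τ : ℂ) (P : ℂ⟦X⟧) (v : ℂ) : Prop :=
  Summable (fun n => ‖coeff n P * τ ^ n‖) ∧ ∑' n, coeff n P * τ ^ n = v

namespace ConvergesAt

variable {τ : ℂ} {P R : ℂ⟦X⟧} {u v : ℂ}

theorem hasSum (h : ConvergesAt τ P v) : HasSum (fun n => τ ^ n * coeff n P) v := by
  have := h.1.of_norm.hasSum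
  rw [h.2] at this
  simpa only [mul_comm] using this

theorem unique (h : ConvergesAt τ P v) (h' : ConvergesAt τ P u) : v = u := h.2.symm.trans h'.2

theorem add (h : ConvergesAt τ P u) (h' : ConvergesAt τ R v) : ConvergesAt τ (P + R) (u + v) := by
  constructor
  · refine Summable.of_nonneg_of_le (fun _ => norm_nonneg _) (fun n => ?_) (h.1.add h'.1)
    rw [map_add, add_mul]
    exact norm_add_le _ _
  · simp only [map_add, add_mul]
    rw [h.1.of_norm.tsum_add h'.1.of_norm, h.2, h'.2]

theorem mul (h : ConvergesAt τ P u) (h' : ConvergesAt τ R v) : ConvergesAt τ (P * R) (u * v) := by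
  have e : ∀ n, coeff n (P * R) * τ ^ n = ∑ kl ∈ Finset.HasAntidiagonal.antidiagonal n,
      coeff kl.1 P * τ ^ kl.1 * (coeff kl.2 R * τ ^ kl.2) := by
    intro n
    rw [coeff_mul, Finset.sum_mul]
    refine Finset.sum_congr rfl fun kl hkl => ?_
    rw [← Finset.HasAntidiagonal.mem_antidiagonal.1 hkl, pow_add]
    ring
  constructor
  · simp only [e]
    exact summable_norm_sum_mul_antidiagonal_of_summable_norm
      (f := fun n => coeff n P * τ ^ n) (g := fun n => coeff n R * τ ^ n) h.1 h'.1
  · simp only [e]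
    rw [← tsum_mul_tsum_eq_tsum_sum_antidiagonal_of_summable_norm
      (f := fun n => coeff n P * τ ^ n) (g := fun n => coeff n R * τ ^ n) h.1 h'.1, h.2, h'.2]

theorem const (a : ℂ) : ConvergesAt τ (C a) a := by
  have h : ∀ n, n ≠ 0 → coeff n (C a) * τ ^ n = 0 := fun n hn => by
    rw [coeff_C, if_neg hn, zero_mul]
  constructor
  · exact summable_of_ne_finset_zero (s := {0}) fun n hn => by
      rw [h n (by simpa using hn), norm_zero]
  · rw [tsum_eq_single 0 h]
    simp

theorem zero : ConvergesAt τ (0 : ℂ⟦X⟧) 0 := by simpa using const (τ := τ) 0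

theorem var : ConvergesAt τ (X : ℂ⟦X⟧) τ := by
  have h : ∀ n, n ≠ 1 → coeff n (X : ℂ⟦X⟧) * τ ^ n = 0 := fun n hn => by
    rw [coeff_X, if_neg hn, zero_mul]
  constructor
  · exact summable_of_ne_finset_zero (s := {1}) fun n hn => by
      rw [h n (by simpa using hn), norm_zero]
  · rw [tsum_eq_single 1 h]
    simp

theorem sub (h : ConvergesAt τ P u) (h' : ConvergesAt τ R v) : ConvergesAt τ (P - R) (u - v) := by
  have := h.add ((const (τ := τ) (-1)).mul h')
  simpa [sub_eq_add_neg] using this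

theorem sum {ι : Type*} {s : Finset ι} {f : ι → ℂ⟦X⟧} {g : ι → ℂ}
    (h : ∀ i ∈ s, ConvergesAt τ (f i) (g i)) : ConvergesAt τ (∑ i ∈ s, f i) (∑ i ∈ s, g i) := by
  induction s using Finset.cons_induction with
  | empty => simpa using zero
  | cons a s ha ih =>
    rw [Finset.sum_cons, Finset.sum_cons]
    exact (h a (Finset.mem_cons_self a s)).add
      (ih fun i hi => h i (Finset.mem_cons_of_mem hi))

theorem prod {ι : Type*} {s : Finset ι} {f : ι → ℂ⟦X⟧} {g : ι → ℂ}
    (h : ∀ i ∈ s, ConvergesAt τ (f i) (g i)) : ConvergesAt τ (∏ i ∈ s, f i) (∏ i ∈ s, g i) := by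
  induction s using Finset.cons_induction with
  | empty => simpa using const (τ := τ) 1
  | cons a s ha ih =>
    rw [Finset.prod_cons, Finset.prod_cons]
    exact (h a (Finset.mem_cons_self a s)).mul
      (ih fun i hi => h i (Finset.mem_cons_of_mem hi))

theorem geometric {a : ℂ} (h : ‖a * τ‖ < 1) :
    ConvergesAt τ (mk fun n => a ^ n) (1 - a * τ)⁻¹ := by
  constructor
  · simpa [← mul_pow] using summable_geometric_of_lt_one (norm_nonneg (a * τ)) h
  · simpa [← mul_pow] using tsum_geometric_of_norm_lt_one h

theorem constantCoeff_eq (h : ConvergesAt 0 P v) : constantCoeff P = v := by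
  rw [← h.2, tsum_eq_single 0 fun n hn => by simp [hn]]
  simp

end ConvergesAt

/-! ### Weighted shifts -/

/-- The weight of the operator `ẑ^*`: `ẑ^* e_m = lam Q τ m • e_{m-1}`, where `τ` is the deformation
parameter. -/
noncomputable def lam (Q τ : ℂ) (m : ℕ) : ℂ := (1 - Q ^ m) / (1 - Q ^ m * τ)

/-- The factor in `ẑ^{*j} e_m = shiftFactor Q τ m j • e_{m-j}`; it vanishes for `m < j`. -/
noncomputable def shiftFactor (Q τ : ℂ) (m j : ℕ) : ℂ := ∏ s ∈ Finset.range j, lam Q τ (m - s)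

theorem lam_zero (Q τ : ℂ) : lam Q τ 0 = 0 := by simp [lam]

theorem shiftFactor_eq_zero {Q τ : ℂ} {m j : ℕ} (h : m < j) : shiftFactor Q τ m j = 0 :=
  Finset.prod_eq_zero (Finset.mem_range.2 h) (by rw [Nat.sub_self, lam_zero])

theorem pow_smul_pow_smul {A V : Type*} [Semiring A] [AddCommGroup V] [Module A V] [Module ℂ V]
    [SMulCommClass A ℂ V] {Z Zs : A} {ε : ℕ → V} {Q τ : ℂ} (hZ : ∀ m, Z • ε m = ε (m + 1))
    (hZs : ∀ m, Zs • ε m = lam Q τ m • ε (m - 1)) (i j m : ℕ) :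
    (Z ^ i * Zs ^ j) • ε m = shiftFactor Q τ m j • ε (m - j + i) := by
  have h1 : Zs ^ j • ε m = shiftFactor Q τ m j • ε (m - j) := by
    induction j with
    | zero => simp [shiftFactor]
    | succ j ih =>
      rw [pow_succ', mul_smul, ih, smul_comm, hZs, smul_smul, shiftFactor, shiftFactor,
        Finset.prod_range_succ, Nat.sub_sub]
  have h2 : ∀ k, Z ^ i • ε k = ε (k + i) := by
    induction i with
    | zero => simp
    | succ i ih => intro k; rw [pow_succ', mul_smul, ih, hZ, add_assoc]
  rw [mul_smul, h1, smul_comm, h2]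

/-- The numerical value at `t = τ` of the series `wSer Q k`. -/
noncomputable def wVal (Q τ : ℂ) (k : ℕ) : ℂ := qPoch (Q * τ) Q k / qPoch Q Q k

section Values

variable {Q τ : ℂ}

theorem pow_ne_one_of_norm_lt_one (hQ : ‖Q‖ < 1) (n : ℕ) : Q ^ (n + 1) ≠ 1 := fun h => by
  have h2 : ‖Q ^ (n + 1)‖ < 1 := by
    rw [norm_pow]
    exact pow_lt_one₀ (norm_nonneg _) hQ (Nat.succ_ne_zero n)
  simp [h] at h2

theorem norm_pow_mul_lt_one (hQ : ‖Q‖ < 1) (hτ : ‖τ‖ < 1) (n : ℕ) : ‖Q ^ n * τ‖ < 1 := by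
  rw [norm_mul, norm_pow]
  exact mul_lt_one_of_nonneg_of_lt_one_right (pow_le_one₀ (norm_nonneg _) hQ.le)
    (norm_nonneg _) hτ

theorem one_sub_pow_mul_ne_zero (hQ : ‖Q‖ < 1) (hτ : ‖τ‖ < 1) (n : ℕ) : 1 - Q ^ n * τ ≠ 0 :=
  fun h => by
    have h2 := norm_pow_mul_lt_one hQ hτ n
    rw [← sub_eq_zero.1 h, norm_one] at h2
    exact lt_irrefl _ h2

theorem wVal_ne_zero (hQ : ‖Q‖ < 1) (hτ : ‖τ‖ < 1) (k : ℕ) : wVal Q τ k ≠ 0 := by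
  refine div_ne_zero (Finset.prod_ne_zero_iff.2 fun i _ => ?_)
    (qPoch_self_ne_zero (pow_ne_one_of_norm_lt_one hQ) k)
  rw [← mul_assoc, ← pow_succ]
  exact one_sub_pow_mul_ne_zero hQ hτ _

theorem wVal_mul_lam (hQ : ‖Q‖ < 1) (hτ : ‖τ‖ < 1) (k : ℕ) :
    wVal Q τ (k + 1) * lam Q τ (k + 1) = wVal Q τ k := by
  have h1 : 1 - τ * Q ^ (k + 1) ≠ 0 := by
    rw [mul_comm]
    exact one_sub_pow_mul_ne_zero hQ hτ (k + 1)
  have h2 := sub_ne_zero.2 (pow_ne_one_of_norm_lt_one hQ k).symm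
  have h3 := qPoch_self_ne_zero (pow_ne_one_of_norm_lt_one hQ) k
  rw [wVal, wVal, lam, qPoch_succ, qPoch_succ, ← mul_assoc, ← pow_succ]
  field_simp

theorem wVal_mul_shiftFactor (hQ : ‖Q‖ < 1) (hτ : ‖τ‖ < 1) {m j : ℕ} (h : j ≤ m) :
    wVal Q τ m * shiftFactor Q τ m j = wVal Q τ (m - j) := by
  induction j with
  | zero => simp [shiftFactor]
  | succ j ih =>
    rw [shiftFactor, Finset.prod_range_succ, ← mul_assoc]
    change wVal Q τ m * shiftFactor Q τ m j * _ = _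
    rw [ih (Nat.le_of_succ_le h), show m - j = m - (j + 1) + 1 by omega, wVal_mul_lam hQ hτ]

theorem shiftFactor_self_ne_zero (hQ : ‖Q‖ < 1) (hτ : ‖τ‖ < 1) (j : ℕ) :
    shiftFactor Q τ j j ≠ 0 := fun h => by
  have := wVal_mul_shiftFactor hQ hτ (le_refl j)
  rw [h, mul_zero] at this
  exact wVal_ne_zero hQ hτ _ this.symm

theorem convergesAt_wSer (τ : ℂ) (k : ℕ) : ConvergesAt τ (wSer Q k) (wVal Q τ k) := by
  rw [wVal, div_eq_inv_mul]
  refine (ConvergesAt.const _).mul (ConvergesAt.prod fun i _ => ?_)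
  rw [← mul_assoc, ← pow_succ]
  simpa using (ConvergesAt.const (τ := τ) 1).sub ((ConvergesAt.const (Q ^ (i + 1))).mul .var)

theorem convergesAt_wInv (hQ : ‖Q‖ < 1) (hτ : ‖τ‖ < 1) (k : ℕ) :
    ConvergesAt τ (wInv Q k) (wVal Q τ k)⁻¹ := by
  rw [wVal, inv_div, div_eq_mul_inv]
  refine (ConvergesAt.const _).mul ?_
  rw [qPoch, ← Finset.prod_inv_distrib]
  refine ConvergesAt.prod fun i _ => ?_
  rw [← mul_assoc, ← pow_succ]
  exact ConvergesAt.geometric (norm_pow_mul_lt_one hQ hτ _)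

/-- The power series of the coefficients of the symbols converge in the unit disc. -/
theorem exists_convergesAt_symbolGen (hQ : ‖Q‖ < 1) (hτ : ‖τ‖ < 1) (b c j : ℕ) :
    ∃ v, ConvergesAt τ (coeff j (symbolGen Q b c)) v := by
  induction j using Nat.strong_induction_on with
  | _ j ih =>
    have h := congrArg (coeff j) (symbolGen_mul_wGen Q b c)
    rw [coeff_mul, Finset.Nat.sum_antidiagonal_eq_sum_range_succ
      (fun k l => coeff k (symbolGen Q b c) * coeff l (wGen Q)), Finset.sum_range_succ,
      Nat.sub_self, coeff_mk] at h
    simp only [wGen, coeff_mk, wSer_zero, mul_one] at h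
    rw [eq_sub_of_add_eq' h]
    have h1 : ∃ v, ConvergesAt τ (shiftSer Q b c j) v := by
      rw [shiftSer]
      split_ifs
      · exact ⟨_, ((convergesAt_wSer τ _).mul (convergesAt_wSer τ _)).mul
          (convergesAt_wInv hQ hτ _)⟩
      · exact ⟨_, .zero⟩
    obtain ⟨v, hv⟩ := h1
    choose! g hg using ih
    exact ⟨_, hv.sub (.sum fun k hk =>
      (hg k (Finset.mem_range.1 hk)).mul (convergesAt_wSer τ _))⟩

theorem coeff_symbolGen_eq_zero {b c j : ℕ} (h : j + c < b) : coeff j (symbolGen Q b c) = 0 := by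
  rw [symbolGen, coeff_mul]
  refine Finset.sum_eq_zero fun kl hkl => ?_
  have := Finset.HasAntidiagonal.mem_antidiagonal.1 hkl
  rw [coeff_mk, shiftSer, if_neg (by omega), mul_zero]

/-- The coefficients of the covariant symbol of `ẑ^{*b} ẑ^c`, as power series in `t`. -/
noncomputable def symbolCoeff (Q : ℂ) (b c : ℕ) (ij : ℕ × ℕ) : ℂ⟦X⟧ :=
  if ij.1 + b = ij.2 + c then coeff ij.2 (symbolGen Q b c) else 0

/-- The values of `symbolCoeff` expand the weight of `ẑ^{*b} ẑ^c` in the weights of the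
`ẑ^i ẑ^{*j}`. -/
theorem exists_symbolCoeff_values (hQ : ‖Q‖ < 1) (hτ : ‖τ‖ < 1) (b c : ℕ) :
    ∃ α : ℕ × ℕ → ℂ, (∀ ij, ConvergesAt τ (symbolCoeff Q b c ij) (α ij)) ∧
      (∀ ij : ℕ × ℕ, ij.1 + b ≠ ij.2 + c → α ij = 0) ∧
      ∀ m, ∑ j ∈ Finset.range (m + 1),
        (if b ≤ j + c then α (j + c - b, j) else 0) * shiftFactor Q τ m j =
          shiftFactor Q τ (m + c) b := by
  choose v hv using exists_convergesAt_symbolGen hQ hτ b c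
  refine ⟨fun ij => if ij.1 + b = ij.2 + c then v ij.2 else 0, fun ij => ?_, fun ij h => if_neg h,
    fun m => ?_⟩
  · dsimp only
    rw [symbolCoeff]
    split_ifs
    exacts [hv _, .zero]
  have h1 : ∀ j, (if b ≤ j + c then (if j + c - b + b = j + c then v j else 0) else 0) = v j := by
    intro j
    split_ifs with h2 h3
    · rfl
    · omega
    · have := hv j
      rw [coeff_symbolGen_eq_zero (not_le.1 h2)] at this
      exact ConvergesAt.zero.unique this
  simp only [h1]
  refine mul_left_cancel₀ (wVal_ne_zero hQ hτ m) ?_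
  have h2 : wVal Q τ m * ∑ j ∈ Finset.range (m + 1), v j * shiftFactor Q τ m j =
      ∑ j ∈ Finset.range (m + 1), v j * wVal Q τ (m - j) := by
    rw [Finset.mul_sum]
    refine Finset.sum_congr rfl fun j hj => ?_
    rw [← wVal_mul_shiftFactor hQ hτ (Nat.le_of_lt_succ (Finset.mem_range.1 hj))]
    ring
  have h := congrArg (coeff m) (symbolGen_mul_wGen Q b c)
  rw [coeff_mul, Finset.Nat.sum_antidiagonal_eq_sum_range_succ
    (fun k l => coeff k (symbolGen Q b c) * coeff l (wGen Q)), coeff_mk] at h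
  simp only [wGen, coeff_mk] at h
  have h3 : ConvergesAt τ (shiftSer Q b c m)
      (∑ j ∈ Finset.range (m + 1), v j * wVal Q τ (m - j)) := by
    rw [← h]
    exact .sum fun j _ => (hv j).mul (convergesAt_wSer τ _)
  rw [h2]
  by_cases hb : b ≤ m + c
  · rw [shiftSer, if_pos hb] at h3
    rw [h3.unique (((convergesAt_wSer τ _).mul (convergesAt_wSer τ _)).mul
      (convergesAt_wInv hQ hτ _)), ← wVal_mul_shiftFactor hQ hτ hb]
    have := wVal_ne_zero hQ hτ (m + c)
    field_simp
  · rw [shiftSer, if_neg hb] at h3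
    rw [shiftFactor_eq_zero (not_le.1 hb), mul_zero]
    exact h3.unique .zero

/-- The coefficient of `e_l` in `∑ α_ij ẑ^i ẑ^{*j} e_m`. -/
noncomputable def matrixEntry (Q τ : ℂ) (α : ℕ × ℕ → ℂ) (m l : ℕ) : ℂ :=
  ∑ j ∈ Finset.range (m + 1), (if m ≤ l + j then α (l + j - m, j) else 0) * shiftFactor Q τ m j

/-- The matrix entries determine the coefficients: the system is triangular, with the nonzero
diagonal entries `shiftFactor Q τ j j`. -/
theorem eq_of_matrixEntry_eq (hQ : ‖Q‖ < 1) (hτ : ‖τ‖ < 1) {α β : ℕ × ℕ → ℂ}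
    (h : ∀ m l, matrixEntry Q τ α m l = matrixEntry Q τ β m l) : α = β := by
  have key : ∀ j i, α (i, j) = β (i, j) := by
    intro j
    induction j using Nat.strong_induction_on with
    | _ j ih =>
      intro i
      have h2 := h j i
      rw [matrixEntry, matrixEntry, Finset.sum_range_succ, Finset.sum_range_succ,
        if_pos (Nat.le_add_left j i), if_pos (Nat.le_add_left j i), Nat.add_sub_cancel] at h2
      rw [Finset.sum_congr rfl fun k hk => by rw [ih k (Finset.mem_range.1 hk)]] at h2
      exact mul_right_cancel₀ (shiftFactor_self_ne_zero hQ hτ j) (add_left_cancel h2)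
  exact funext fun ij => key ij.2 ij.1

theorem matrixEntry_of_diagonal {α : ℕ × ℕ → ℂ} {b c : ℕ}
    (h0 : ∀ ij : ℕ × ℕ, ij.1 + b ≠ ij.2 + c → α ij = 0)
    (h : ∀ m, ∑ j ∈ Finset.range (m + 1),
      (if b ≤ j + c then α (j + c - b, j) else 0) * shiftFactor Q τ m j =
        shiftFactor Q τ (m + c) b) (m l : ℕ) :
    matrixEntry Q τ α m l = if m + c - b = l then shiftFactor Q τ (m + c) b else 0 := by
  rw [matrixEntry]
  by_cases hl : l + b = m + c
  · rw [if_pos (by omega), ← h]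
    refine Finset.sum_congr rfl fun j _ => ?_
    have h2 : m ≤ l + j ↔ b ≤ j + c := by omega
    simp only [h2]
    rw [show l + j - m = j + c - b by omega]
  · have h1 : (if m + c - b = l then shiftFactor Q τ (m + c) b else 0) = 0 := by
      split_ifs
      · exact shiftFactor_eq_zero (by omega)
      · rfl
    rw [h1]
    refine Finset.sum_eq_zero fun j _ => ?_
    split_ifs
    · rw [h0 _ (by dsimp only; omega), zero_mul]
    · rw [zero_mul]

theorem matrixEntry_single (i j m l : ℕ) :
    matrixEntry Q τ (Pi.single (i, j) 1) m l =
      if m - j + i = l then shiftFactor Q τ m j else 0 := by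
  rw [matrixEntry]
  by_cases hj : j ≤ m
  · rw [Finset.sum_eq_single j]
    · by_cases hl : m - j + i = l
      · rw [if_pos (by omega), if_pos hl, show l + j - m = i by omega]
        simp
      · rw [if_neg hl]
        split_ifs
        · rw [Pi.single_eq_of_ne (by simp only [ne_eq, Prod.mk.injEq]; omega), zero_mul]
        · rw [zero_mul]
    · intro k _ hk
      split_ifs
      · rw [Pi.single_eq_of_ne (by simp [hk]), zero_mul]
      · rw [zero_mul]
    · intro h
      exact absurd (Finset.mem_range.2 (Nat.lt_succ_of_le hj)) h
  · rw [shiftFactor_eq_zero (not_le.1 hj), ite_self]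
    refine Finset.sum_eq_zero fun k hk => ?_
    have := Finset.mem_range.1 hk
    split_ifs
    · rw [Pi.single_eq_of_ne (by simp only [ne_eq, Prod.mk.injEq]; omega), zero_mul]
    · rw [zero_mul]

end Values

/-! ### Identification of the two families of power series -/

theorem norm_c_sq_lt_one (q : Param) : ‖q.c ^ 2‖ < 1 := by
  rw [norm_pow, Param.c, Complex.norm_real, Real.norm_eq_abs, abs_of_pos q.2.1]
  exact pow_lt_one₀ q.2.1.le q.2.2 two_ne_zero

theorem norm_c_lt_one (t : Param) : ‖t.c‖ < 1 := by
  rw [Param.c, Complex.norm_real, Real.norm_eq_abs, abs_of_pos t.2.1]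
  exact t.2.2

theorem Pol.linear_induction {q : Param} {P : Pol q → Prop} (h0 : P 0)
    (hadd : ∀ f g, P f → P g → P (f + g)) (hsmul : ∀ (c : ℂ) f, P f → P (c • f))
    (hmono : ∀ i j, P (Pol.z q ^ i * Pol.zs q ^ j)) (f : Pol q) : P f := by
  induction (Pol.basis q).mem_span f using Submodule.span_induction with
  | mem x hx =>
    obtain ⟨⟨i, j⟩, rfl⟩ := hx
    rw [Pol.basis_apply]
    exact hmono i j
  | zero => exact h0
  | add x y _ _ hx hy => exact hadd x y hx hy
  | smul c x _ hx => exact hsmul c x hx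

theorem repr_monomial {q : Param} (i j : ℕ) :
    (Pol.basis q).repr (Pol.z q ^ i * Pol.zs q ^ j) = Finsupp.single (i, j) 1 := by
  rw [← Pol.basis_apply, Module.Basis.repr_self]

theorem matrixEntry_add (Q τ : ℂ) (α β : ℕ × ℕ → ℂ) (m l : ℕ) :
    matrixEntry Q τ (α + β) m l = matrixEntry Q τ α m l + matrixEntry Q τ β m l := by
  rw [matrixEntry, matrixEntry, matrixEntry, ← Finset.sum_add_distrib]
  refine Finset.sum_congr rfl fun j _ => ?_
  split_ifs <;> simp [add_mul]

theorem matrixEntry_smul (Q τ c : ℂ) (α : ℕ × ℕ → ℂ) (m l : ℕ) :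
    matrixEntry Q τ (c • α) m l = c * matrixEntry Q τ α m l := by
  rw [matrixEntry, matrixEntry, Finset.mul_sum]
  refine Finset.sum_congr rfl fun j _ => ?_
  split_ifs <;> simp [mul_assoc]

/-- The representation of `Pol(ℂ)_q` by the shift `e_m ↦ e_{m+1}` and the weighted backward shift
`e_m ↦ (1 - q^(2m)) e_{m-1}`: the quantization at the parameter `t = 0`, without completion. -/
noncomputable def fockRep (q : Param) : Pol q →ₐ[ℂ] Module.End ℂ (ℕ →₀ ℂ) :=
  Pol.lift (Finsupp.lsum ℂ fun m => Finsupp.lsingle (m + 1))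
    (Finsupp.lsum ℂ fun m => lam (q.c ^ 2) 0 m • Finsupp.lsingle (m - 1)) (by
      ext m : 2
      simp only [LinearMap.comp_apply, Module.End.mul_apply, LinearMap.add_apply,
        LinearMap.smul_apply, Module.End.one_apply, Finsupp.lsingle_apply, Finsupp.lsum_single,
        map_smul, Nat.add_sub_cancel]
      rcases m with _ | m
      · simp [lam]
      · simp only [Nat.add_sub_cancel, smul_smul, ← add_smul, lam, mul_zero, sub_zero, div_one]
        congr 1
        ring)

theorem fockRep_z {q : Param} (m : ℕ) :
    fockRep q (Pol.z q) • Finsupp.single m (1 : ℂ) = Finsupp.single (m + 1) 1 := by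
  rw [fockRep, Pol.lift_z, Module.End.smul_def]
  simp

theorem fockRep_zs {q : Param} (m : ℕ) :
    fockRep q (Pol.zs q) • Finsupp.single m (1 : ℂ) =
      lam (q.c ^ 2) 0 m • Finsupp.single (m - 1) (1 : ℂ) := by
  rw [fockRep, Pol.lift_zs, Module.End.smul_def]
  simp

theorem fockRep_monomial {q : Param} (i j m : ℕ) :
    fockRep q (Pol.z q ^ i * Pol.zs q ^ j) (Finsupp.single m 1) =
      shiftFactor (q.c ^ 2) 0 m j • Finsupp.single (m - j + i) (1 : ℂ) := by
  rw [map_mul, map_pow, map_pow]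
  exact pow_smul_pow_smul (ε := fun m => Finsupp.single m (1 : ℂ)) fockRep_z fockRep_zs i j m

theorem fockRep_apply {q : Param} (f : Pol q) (m l : ℕ) :
    fockRep q f (Finsupp.single m 1) l =
      matrixEntry (q.c ^ 2) 0 ((Pol.basis q).repr f) m l := by
  induction f using Pol.linear_induction with
  | h0 => simp [matrixEntry]
  | hadd f g hf hg =>
    rw [map_add, map_add, Finsupp.coe_add, matrixEntry_add, ← hf, ← hg]
    rfl
  | hsmul c f hf =>
    rw [map_smul, map_smul, Finsupp.coe_smul, matrixEntry_smul, ← hf]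
    rfl
  | hmono i j =>
    rw [repr_monomial, Finsupp.single_eq_pi_single, matrixEntry_single, fockRep_monomial]
    simp [Finsupp.single_apply]

/-- At `t = 0` the deformed product is the product of `Pol(ℂ)_q`. -/
theorem constantCoeff_symbolCoeff {q : Param} (b c : ℕ) (ij : ℕ × ℕ) :
    constantCoeff (symbolCoeff (q.c ^ 2) b c ij) =
      (Pol.basis q).repr (Pol.zs q ^ b * Pol.z q ^ c) ij := by
  have h0 : ‖(0 : ℂ)‖ < 1 := by simp
  obtain ⟨α, h1, h2, h3⟩ := exists_symbolCoeff_values (norm_c_sq_lt_one q) h0 b c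
  rw [(h1 ij).constantCoeff_eq]
  refine congrFun (eq_of_matrixEntry_eq (norm_c_sq_lt_one q) h0 fun m l => ?_) ij
  rw [matrixEntry_of_diagonal h2 h3, ← fockRep_apply, map_mul, Module.End.mul_apply]
  have e1 := fockRep_monomial (q := q) c 0 m
  have e2 := fockRep_monomial (q := q) 0 b (m + c)
  rw [pow_zero, mul_one, Nat.sub_zero, shiftFactor, Finset.range_zero, Finset.prod_empty,
    one_smul] at e1
  rw [pow_zero, one_mul, add_zero] at e2
  rw [e1, e2]
  simp [Finsupp.single_apply]

/-- The `q`-difference equation of the coefficients of the symbols, matching `boxSeries_box`. -/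
theorem symbolCoeff_qdiff {Q : ℂ} (h0 : Q ≠ 0) (h1 : ∀ n, Q ^ (n + 1) ≠ 1) (b c : ℕ)
    (ij : ℕ × ℕ) :
    X * ((Q * (1 - Q⁻¹ ^ b) * (1 - Q⁻¹ ^ c)) •
        (symbolCoeff Q (b - 1) (c - 1) ij - (1 + Q⁻¹) • symbolCoeff Q b c ij +
          Q⁻¹ • symbolCoeff Q (b + 1) (c + 1) ij)) =
      (1 - X) * (1 - C Q * X) * (symbolCoeff Q b c ij - rescale Q (symbolCoeff Q b c ij)) := by
  have h := congrArg (coeff ij.2) (symbolGen_qdiff h0 h1 b c)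
  generalize (1 + Q⁻¹ : ℂ) = r at h ⊢
  simp only [coeff_C_mul, map_add, map_sub, coeff_map] at h
  rcases Nat.eq_zero_or_pos b with rfl | hb
  · simp only [pow_zero, sub_self, mul_zero, zero_mul, map_zero, zero_smul] at h ⊢
    simp only [symbolCoeff]
    split_ifs
    · exact h
    · simp
  rcases Nat.eq_zero_or_pos c with rfl | hc
  · simp only [pow_zero, sub_self, mul_zero, zero_mul, map_zero, zero_smul] at h ⊢
    simp only [symbolCoeff]
    split_ifs
    · exact h
    · simp
  have e1 : ij.1 + (b - 1) = ij.2 + (c - 1) ↔ ij.1 + b = ij.2 + c := by omega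
  have e2 : ij.1 + (b + 1) = ij.2 + (c + 1) ↔ ij.1 + b = ij.2 + c := by omega
  simp only [symbolCoeff, e1, e2]
  split_ifs
  · simp only [smul_eq_C_mul]
    exact h
  · simp

/-- The series `(1 - t) ∑_j t^j m(p_j(□) (z^{*b} ⊗ z^c))` has the coefficients of the covariant
symbol of `ẑ^{*b} ẑ^c`: both solve the same `q`-difference equation with the same value at
`t = 0`. -/
theorem boxSeries_eq_symbolCoeff (q : Param) (b c : ℕ) (ij : ℕ × ℕ) :
    boxSeries q ((Pol.basis q).coord ij) ((Pol.zs q ^ b) ⊗ₜ (Pol.z q ^ c)) =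
      symbolCoeff (q.c ^ 2) b c ij := by
  set Q := q.c ^ 2 with hQ
  have h0 : Q ≠ 0 := pow_ne_zero 2 q.c_ne_zero
  have h1 : ∀ n, Q ^ (n + 1) ≠ 1 := pow_ne_one_of_norm_lt_one (norm_c_sq_lt_one q)
  let S : ℕ × ℕ → ℂ⟦X⟧ := fun bc =>
    boxSeries q ((Pol.basis q).coord ij) ((Pol.zs q ^ bc.1) ⊗ₜ (Pol.z q ^ bc.2))
  let T : ℕ × ℕ → ℂ⟦X⟧ := fun bc => S bc - symbolCoeff Q bc.1 bc.2 ij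
  have hS : ∀ bc : ℕ × ℕ, X * ((Q * (1 - Q⁻¹ ^ bc.1) * (1 - Q⁻¹ ^ bc.2)) •
        (S (bc.1 - 1, bc.2 - 1) - (1 + Q⁻¹) • S bc + Q⁻¹ • S (bc.1 + 1, bc.2 + 1))) =
      (1 - X) * (1 - C Q * X) * (S bc - rescale Q (S bc)) := by
    intro bc
    have := boxSeries_box h1 ((Pol.basis q).coord ij) ((Pol.zs q ^ bc.1) ⊗ₜ (Pol.z q ^ bc.2))
    rw [← this, box_zs_pow_tmul_z_pow, ← sq_mul_boxFactor h0]
    simp only [map_smul, map_add, map_sub, smul_smul, S, ← hQ]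
  have hT := eq_zero_of_qdiff h1 (T := T)
    (T' := fun bc => (Q * (1 - Q⁻¹ ^ bc.1) * (1 - Q⁻¹ ^ bc.2)) •
      (T (bc.1 - 1, bc.2 - 1) - (1 + Q⁻¹) • T bc + Q⁻¹ • T (bc.1 + 1, bc.2 + 1)))
    (fun n hn bc => by
      simp only [smul_eq_C_mul]
      exact ((((hn _).sub ((hn _).mul_left _)).add ((hn _).mul_left _))).mul_left _)
    (fun bc => by
      have e1 := hS bc
      have e2 := symbolCoeff_qdiff h0 h1 bc.1 bc.2 ij
      simp only [T, map_sub, smul_eq_C_mul] at e1 e2 ⊢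
      linear_combination e1 - e2)
    (fun bc => by
      simp only [T, S]
      rw [map_sub, constantCoeff_boxSeries, constantCoeff_symbolCoeff]
      exact sub_self _) (b, c)
  exact sub_eq_zero.1 hT

/-! ### Operators on the Hilbert space -/

theorem normSq_succ (q t : Param) (k : ℕ) :
    (normSq q t (k + 1) : ℂ) = lam (q.c ^ 2) t.c (k + 1) * (normSq q t k : ℂ) := by
  have h : normSq q t (k + 1) = (1 - ((q : ℝ) ^ 2) ^ (k + 1)) /
      (1 - ((q : ℝ) ^ 2) ^ (k + 1) * t) * normSq q t k := by
    rw [normSq, normSq, qPoch_succ, qPoch_succ, div_mul_div_comm, ← mul_assoc, ← pow_succ,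
      mul_comm (1 - _), mul_comm (1 - _)]
  rw [h, lam, Param.c, Param.c]
  push_cast
  ring

theorem inner_e_apply (q t : Param) (n : ℕ) (x : Hil) :
    inner ℂ (e q t n) x = ((√(normSq q t n) : ℝ) : ℂ) * x n := by
  rw [e, lp.inner_single_left]
  simp [mul_comm]

theorem inner_e_e (q t : Param) (m n : ℕ) :
    inner ℂ (e q t m) (e q t n) = if n = m then (normSq q t m : ℂ) else 0 := by
  split_ifs with h
  · rw [h, inner_self_eq_norm_sq_to_K, ← norm_sq_e]
    simp
  · exact inner_e q t (Ne.symm h)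

theorem sqrt_normSq_ne_zero (q t : Param) (m : ℕ) : ((√(normSq q t m) : ℝ) : ℂ) ≠ 0 := by
  exact_mod_cast (Real.sqrt_pos.2 (normSq_pos q t m)).ne'

theorem zsHat_e (q t : Param) (m : ℕ) :
    zsHat q t (e q t m) = lam (q.c ^ 2) t.c m • e q t (m - 1) := by
  have h : ∀ n, inner ℂ (e q t n) (zsHat q t (e q t m)) =
      inner ℂ (e q t n) (lam (q.c ^ 2) t.c m • e q t (m - 1)) := by
    intro n
    rw [zsHat, ContinuousLinearMap.adjoint_inner_right, zHat_e, inner_e_e, inner_smul_right,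
      inner_e_e]
    rcases m with _ | m
    · simp [lam_zero]
    · simp only [Nat.add_right_cancel_iff, Nat.add_sub_cancel]
      split_ifs with h
      · rw [normSq_succ, h]
      · simp
  ext n
  have := h n
  rw [inner_e_apply, inner_e_apply] at this
  exact mul_left_cancel₀ (sqrt_normSq_ne_zero q t n) this

theorem zHat_pow_mul_zsHat_pow_e (q t : Param) (i j m : ℕ) :
    (zHat q t ^ i * zsHat q t ^ j) (e q t m) =
      shiftFactor (q.c ^ 2) t.c m j • e q t (m - j + i) :=
  pow_smul_pow_smul (A := Hil →L[ℂ] Hil) (zHat_e q t) (zsHat_e q t) i j m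

theorem hasSum_sum_of_injective {ι κ V : Type*} [AddCommMonoid V] [TopologicalSpace V] {g : κ → ι}
    (hg : Function.Injective g) (s : Finset κ) {f : ι → V}
    (h : ∀ i, (∀ k ∈ s, g k ≠ i) → f i = 0) : HasSum f (∑ k ∈ s, f (g k)) := by
  have e : ∑ k ∈ s, f (g k) = ∑ i ∈ s.map ⟨g, hg⟩, f i := (Finset.sum_map s ⟨g, hg⟩ f).symm
  rw [e]
  exact hasSum_sum_of_ne_finset_zero fun i hi => h i fun k hk hki =>
    hi (Finset.mem_map.2 ⟨k, hk, hki⟩)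

/-- A covariant symbol is determined by the operator. -/
theorem HasCovariantSymbol.unique {q t : Param} {A : Hil →L[ℂ] Hil} {α β : ℕ × ℕ → ℂ}
    (hα : HasCovariantSymbol q t A α) (hβ : HasCovariantSymbol q t A β) : α = β := by
  have key : ∀ {α : ℕ × ℕ → ℂ}, HasCovariantSymbol q t A α → ∀ m l,
      matrixEntry (q.c ^ 2) t.c α m l * (normSq q t l : ℂ) =
        inner ℂ (e q t l) (A (e q t m)) := by
    intro α h m l
    have h1 := (innerSL ℂ (e q t l)).hasSum (h m)
    refine HasSum.unique ?_ h1
    rw [matrixEntry, Finset.sum_mul]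
    -- only the pairs `(l + j - m, j)` with `j ≤ m` contribute to the coordinate `l`
    have hinj : Function.Injective fun j : ℕ => (l + j - m, j) := fun a b hab => by
      simpa using congrArg Prod.snd hab
    have hterm : ∀ ij : ℕ × ℕ, (innerSL ℂ (e q t l))
        (α ij • (zHat q t ^ ij.1 * zsHat q t ^ ij.2) (e q t m)) =
          if m - ij.2 + ij.1 = l then
            α ij * shiftFactor (q.c ^ 2) t.c m ij.2 * (normSq q t l : ℂ) else 0 := by
      intro ij
      rw [zHat_pow_mul_zsHat_pow_e, innerSL_apply_apply, inner_smul_right, inner_smul_right,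
        inner_e_e]
      split_ifs <;> ring
    simp only [hterm]
    have h2 : ∀ j ∈ Finset.range (m + 1),
        (if m ≤ l + j then α (l + j - m, j) else 0) * shiftFactor (q.c ^ 2) t.c m j *
          (normSq q t l : ℂ) = (fun ij : ℕ × ℕ => if m - ij.2 + ij.1 = l then
            α ij * shiftFactor (q.c ^ 2) t.c m ij.2 * (normSq q t l : ℂ) else 0)
              (l + j - m, j) := by
      intro j hj
      have := Finset.mem_range.1 hj
      have h3 : m ≤ l + j ↔ m - j + (l + j - m) = l := by omega
      simp only [h3, ite_mul, zero_mul]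
    rw [Finset.sum_congr rfl h2]
    refine hasSum_sum_of_injective hinj _ fun ij hij => ?_
    by_cases hj : ij.2 ≤ m
    · refine if_neg fun hl => hij ij.2 (Finset.mem_range.2 (by omega)) ?_
      exact Prod.ext (by dsimp only; omega) rfl
    · rw [shiftFactor_eq_zero (not_le.1 hj)]
      simp
  refine eq_of_matrixEntry_eq (norm_c_sq_lt_one q) (norm_c_lt_one t) fun m l => ?_
  have hl : (normSq q t l : ℂ) ≠ 0 := by exact_mod_cast (normSq_pos q t l).ne'
  exact mul_right_cancel₀ hl ((key hα m l).trans (key hβ m l).symm)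

/-- Coefficients on one diagonal that expand the weight of `ẑ^{*b} ẑ^c` form its symbol. -/
theorem hasCovariantSymbol_of_diagonal {q t : Param} {α : ℕ × ℕ → ℂ} {b c : ℕ}
    (h0 : ∀ ij : ℕ × ℕ, ij.1 + b ≠ ij.2 + c → α ij = 0)
    (h : ∀ m, ∑ j ∈ Finset.range (m + 1),
      (if b ≤ j + c then α (j + c - b, j) else 0) * shiftFactor (q.c ^ 2) t.c m j =
        shiftFactor (q.c ^ 2) t.c (m + c) b) :
    HasCovariantSymbol q t (zsHat q t ^ b * zHat q t ^ c) α := by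
  intro m
  have e1 : (zsHat q t ^ b * zHat q t ^ c) (e q t m) =
      shiftFactor (q.c ^ 2) t.c (m + c) b • e q t (m + c - b) := by
    have h1 := zHat_pow_mul_zsHat_pow_e q t c 0 m
    have h2 := zHat_pow_mul_zsHat_pow_e q t 0 b (m + c)
    rw [pow_zero, mul_one, Nat.sub_zero, shiftFactor, Finset.range_zero, Finset.prod_empty,
      one_smul] at h1
    rw [pow_zero, one_mul, add_zero] at h2
    rw [mul_apply_eq_comp, h1, h2]
  rw [e1, ← h, Finset.sum_smul]
  have hinj : Function.Injective fun j : ℕ => (j + c - b, j) := fun a b hab => by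
    simpa using congrArg Prod.snd hab
  have h2 : ∀ j ∈ Finset.range (m + 1),
      ((if b ≤ j + c then α (j + c - b, j) else 0) * shiftFactor (q.c ^ 2) t.c m j) •
        e q t (m + c - b) =
      (fun ij : ℕ × ℕ => α ij • (zHat q t ^ ij.1 * zsHat q t ^ ij.2) (e q t m))
        (j + c - b, j) := by
    intro j hj
    have := Finset.mem_range.1 hj
    dsimp only
    rw [zHat_pow_mul_zsHat_pow_e, smul_smul]
    split_ifs with hb
    · rw [show m - j + (j + c - b) = m + c - b by omega]
    · rw [h0 (j + c - b, j) (by dsimp only; omega), zero_mul, zero_smul, zero_smul]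
  rw [Finset.sum_congr rfl h2]
  refine hasSum_sum_of_injective hinj _ fun ij hij => ?_
  by_cases hd : ij.1 + b = ij.2 + c
  · have hj : m < ij.2 := by
      by_contra hj
      refine hij ij.2 (Finset.mem_range.2 (by omega)) ?_
      exact Prod.ext (by dsimp only; omega) rfl
    rw [zHat_pow_mul_zsHat_pow_e, shiftFactor_eq_zero hj, zero_smul, smul_zero]
  · rw [h0 ij hd, zero_smul]

/-! ### Bilinearity and uniqueness of the deformed product -/

/-- The series `F = ∑_n t^n F_n` is, for every `t ∈ (0,1)`, a covariant symbol of `A t`. -/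
def IsSymbolSeries (q : Param) (A : Param → Hil →L[ℂ] Hil) (F : PowerSeries (Pol q)) : Prop :=
  ∀ t : Param, ∃ a : ℕ × ℕ → ℂ,
    (∀ ij, HasSum (fun n : ℕ => t.c ^ n * (Pol.basis q).repr (coeff n F) ij) (a ij)) ∧
    HasCovariantSymbol q t (A t) a

namespace IsSymbolSeries

variable {q : Param} {A B : Param → Hil →L[ℂ] Hil} {F G : PowerSeries (Pol q)}

theorem zero : IsSymbolSeries q (fun _ => 0) 0 := fun t =>
  ⟨0, fun ij => by simp, fun m => by simp⟩

theorem add (hF : IsSymbolSeries q A F) (hG : IsSymbolSeries q B G) :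
    IsSymbolSeries q (fun t => A t + B t) (F + G) := fun t => by
  obtain ⟨a, h1, h2⟩ := hF t
  obtain ⟨b, h3, h4⟩ := hG t
  refine ⟨a + b, fun ij => ?_, fun m => ?_⟩
  · simpa [mul_add] using (h1 ij).add (h3 ij)
  · simpa [add_smul] using (h2 m).add (h4 m)

theorem smul (c : ℂ) (hF : IsSymbolSeries q A F) :
    IsSymbolSeries q (fun t => c • A t) (c • F) := fun t => by
  obtain ⟨a, h1, h2⟩ := hF t
  refine ⟨c • a, fun ij => ?_, fun m => ?_⟩
  · simpa [mul_left_comm] using (h1 ij).mul_left c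
  · simpa [mul_smul] using (h2 m).const_smul c

end IsSymbolSeries

theorem hat_monomial (q t : Param) (i j : ℕ) :
    hat q t (Pol.z q ^ i * Pol.zs q ^ j) = zHat q t ^ i * zsHat q t ^ j := by
  rw [← Pol.basis_apply, hat, Module.Basis.constr_basis]

theorem repr_z_pow_mul_mul_zs_pow {q : Param} (a d : ℕ) (f : Pol q) (ij : ℕ × ℕ) :
    (Pol.basis q).repr (Pol.z q ^ a * f * Pol.zs q ^ d) ij =
      if a ≤ ij.1 ∧ d ≤ ij.2 then (Pol.basis q).repr f (ij.1 - a, ij.2 - d) else 0 := by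
  induction f using Pol.linear_induction with
  | h0 => simp
  | hadd f g hf hg =>
    rw [mul_add, add_mul, map_add, Finsupp.add_apply, hf, hg, map_add, Finsupp.add_apply]
    split_ifs <;> simp
  | hsmul c f hf =>
    rw [mul_smul_comm, smul_mul_assoc, map_smul, Finsupp.smul_apply, hf, map_smul,
      Finsupp.smul_apply]
    split_ifs <;> simp
  | hmono i j =>
    have e : Pol.z q ^ a * (Pol.z q ^ i * Pol.zs q ^ j) * Pol.zs q ^ d =
        Pol.z q ^ (a + i) * Pol.zs q ^ (j + d) := by
      simp only [pow_add, mul_assoc]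
    rw [e, repr_monomial, repr_monomial, Finsupp.single_apply, Finsupp.single_apply, ← ite_and]
    obtain ⟨k, l⟩ := ij
    simp only [Prod.mk.injEq]
    congr 1
    exact propext ⟨fun h => by omega, fun h => by omega⟩

/-- Symbols are compatible with left multiplication by `z` and right multiplication by `z^*`. -/
theorem IsSymbolSeries.z_pow_mul_mul_zs_pow {q : Param} {A : Param → Hil →L[ℂ] Hil}
    {F G : PowerSeries (Pol q)} (h : IsSymbolSeries q A F) (a d : ℕ)
    (hG : ∀ n, coeff n G = Pol.z q ^ a * coeff n F * Pol.zs q ^ d) :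
    IsSymbolSeries q (fun t => zHat q t ^ a * A t * zsHat q t ^ d) G := fun t => by
  obtain ⟨α, h1, h2⟩ := h t
  refine ⟨fun ij => if a ≤ ij.1 ∧ d ≤ ij.2 then α (ij.1 - a, ij.2 - d) else 0, fun ij => ?_,
    fun m => ?_⟩
  · simp only [hG, repr_z_pow_mul_mul_zs_pow]
    split_ifs
    · exact h1 _
    · simp
  have e1 : ∀ k, (zsHat q t ^ k) (e q t m) =
      shiftFactor (q.c ^ 2) t.c m k • e q t (m - k) := by
    intro k
    simpa using zHat_pow_mul_zsHat_pow_e q t 0 k m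
  have hinj : Function.Injective fun ij : ℕ × ℕ => (ij.1 + a, ij.2 + d) := fun x y hxy => by
    simp only [Prod.mk.injEq, Nat.add_right_cancel_iff] at hxy
    exact Prod.ext hxy.1 hxy.2
  refine (hinj.hasSum_iff fun ij hij => ?_).1 ?_
  · dsimp only
    rw [if_neg fun hle => hij ⟨(ij.1 - a, ij.2 - d), Prod.ext (Nat.sub_add_cancel hle.1)
      (Nat.sub_add_cancel hle.2)⟩, zero_smul]
  have h3 := (shiftFactor (q.c ^ 2) t.c m d • zHat q t ^ a).hasSum (h2 (m - d))
  have e2 : (zHat q t ^ a * A t * zsHat q t ^ d) (e q t m) =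
      (shiftFactor (q.c ^ 2) t.c m d • zHat q t ^ a) (A t (e q t (m - d))) := by
    change (zHat q t ^ a) (A t ((zsHat q t ^ d) (e q t m))) = _
    rw [e1, map_smul, map_smul]
    rfl
  rw [e2]
  convert h3 using 2 with ij
  have e3 : (zHat q t ^ (ij.1 + a) * zsHat q t ^ (ij.2 + d)) (e q t m) =
      (shiftFactor (q.c ^ 2) t.c m d • zHat q t ^ a)
        ((zHat q t ^ ij.1 * zsHat q t ^ ij.2) (e q t (m - d))) := by
    have : zHat q t ^ (ij.1 + a) * zsHat q t ^ (ij.2 + d) =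
        zHat q t ^ a * (zHat q t ^ ij.1 * zsHat q t ^ ij.2) * zsHat q t ^ d := by
      rw [add_comm ij.1, pow_add, pow_add]
      simp only [mul_assoc]
    rw [this]
    change (zHat q t ^ a) ((zHat q t ^ ij.1 * zsHat q t ^ ij.2) ((zsHat q t ^ d) (e q t m))) = _
    rw [e1, map_smul, map_smul]
    rfl
  simp only [Function.comp_apply, Nat.le_add_left, and_self, if_true, Nat.add_sub_cancel]
  rw [e3, map_smul]

/-- The series `(1 - t) ∑_j t^j m(p_j(□) (f ⊗ g))`. -/
noncomputable def starSeries (q : Param) (f g : Pol q) : PowerSeries (Pol q) :=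
  (1 - X) * mk fun j => coeffTerm q f g j

theorem coeff_starSeries {q : Param} (f g : Pol q) (n : ℕ) :
    coeff n (starSeries q f g) =
      coeffTerm q f g n - if n = 0 then 0 else coeffTerm q f g (n - 1) := by
  rw [starSeries, sub_mul, one_mul, map_sub, coeff_mk]
  rcases n with _ | n
  · simp
  · simp [coeff_succ_X_mul]

theorem isSymbolSeries_starSeries_pow (q : Param) (b c : ℕ) :
    IsSymbolSeries q (fun t => zsHat q t ^ b * zHat q t ^ c)
      (starSeries q (Pol.zs q ^ b) (Pol.z q ^ c)) := fun t => by
  obtain ⟨α, h1, h2, h3⟩ :=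
    exists_symbolCoeff_values (norm_c_sq_lt_one q) (norm_c_lt_one t) b c
  refine ⟨α, fun ij => ?_, hasCovariantSymbol_of_diagonal h2 h3⟩
  have h4 : ∀ n, (Pol.basis q).repr (coeff n (starSeries q (Pol.zs q ^ b) (Pol.z q ^ c))) ij =
      coeff n (symbolCoeff (q.c ^ 2) b c ij) := by
    intro n
    rw [← boxSeries_eq_symbolCoeff, coeff_boxSeries]
    rfl
  simp only [h4]
  exact (h1 ij).hasSum

/-- The formula defines a deformed product: by bilinearity it suffices to consider monomials, and
outer factors `z^a` and `z^{*d}` can be split off. -/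
theorem isStarProduct_starSeries (q : Param) (f g : Pol q) :
    IsStarProduct q f g (starSeries q f g) := by
  change IsSymbolSeries q (fun t => hat q t f * hat q t g) (starSeries q f g)
  induction f using Pol.linear_induction with
  | h0 =>
    have e : starSeries q 0 g = 0 := by ext1 n; simp [coeff_starSeries, coeffTerm]
    simpa [e] using IsSymbolSeries.zero
  | hadd f₁ f₂ h₁ h₂ =>
    have e : starSeries q (f₁ + f₂) g = starSeries q f₁ g + starSeries q f₂ g := by
      rw [starSeries, starSeries, starSeries, ← mul_add]
      congr 1
      ext1 n
      simp [coeffTerm, TensorProduct.add_tmul]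
    simpa [e, add_mul] using h₁.add h₂
  | hsmul r f h =>
    have e : starSeries q (r • f) g = r • starSeries q f g := by
      rw [starSeries, starSeries, ← mul_smul_comm]
      congr 1
      ext1 n
      simp [coeffTerm, ← TensorProduct.smul_tmul']
    simpa [e] using h.smul r
  | hmono a b =>
    induction g using Pol.linear_induction with
    | h0 =>
      have e : starSeries q (Pol.z q ^ a * Pol.zs q ^ b) 0 = 0 := by
        ext1 n; simp [coeff_starSeries, coeffTerm]
      simpa [e] using IsSymbolSeries.zero
    | hadd g₁ g₂ h₁ h₂ =>
      have e : ∀ f, starSeries q f (g₁ + g₂) = starSeries q f g₁ + starSeries q f g₂ := by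
        intro f
        rw [starSeries, starSeries, starSeries, ← mul_add]
        congr 1
        ext1 n
        simp [coeffTerm, TensorProduct.tmul_add]
      simpa [e, mul_add] using h₁.add h₂
    | hsmul r g h =>
      have e : ∀ f, starSeries q f (r • g) = r • starSeries q f g := by
        intro f
        rw [starSeries, starSeries, ← mul_smul_comm]
        congr 1
        ext1 n
        simp [coeffTerm]
      simpa [e] using h.smul r
    | hmono c d =>
      have h := (isSymbolSeries_starSeries_pow q b c).z_pow_mul_mul_zs_pow a d
        (G := starSeries q (Pol.z q ^ a * Pol.zs q ^ b) (Pol.z q ^ c * Pol.zs q ^ d)) fun n => by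
          rw [coeff_starSeries, coeff_starSeries, coeffTerm_z_pow_mul_mul_zs_pow,
            coeffTerm_z_pow_mul_mul_zs_pow]
          split_ifs <;> simp [mul_sub, sub_mul]
      simpa only [hat_monomial, mul_assoc] using h

/-- A power series that converges to zero on the interval `(0,1)` is zero. -/
theorem eq_zero_of_hasSum_Ioo {c : ℕ → ℂ}
    (h : ∀ t : Param, HasSum (fun n => t.c ^ n * c n) 0) : ∀ n, c n = 0 := by
  let P : FormalMultilinearSeries ℂ ℂ ℂ := FormalMultilinearSeries.ofScalars ℂ c
  have hval : ∀ x, P.sum x = ∑' n, x ^ n * c n := fun x => by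
    simp only [FormalMultilinearSeries.sum, P, FormalMultilinearSeries.ofScalars_apply_eq,
      smul_eq_mul, mul_comm]
  let half : Param := ⟨1 / 2, by norm_num, by norm_num⟩
  have hr : 0 < P.radius := by
    refine lt_of_lt_of_le (b := (((1 / 2 : NNReal)) : ENNReal)) (by norm_num)
      (P.le_radius_of_tendsto (l := 0) ?_)
    have h2 := (h half).summable.tendsto_atTop_zero.norm
    rw [norm_zero] at h2
    refine h2.congr fun n => ?_
    simp [P, half, Param.c, mul_comm]
  have hP := (P.hasFPowerSeriesOnBall hr).hasFPowerSeriesAt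
  -- the sum vanishes at the points `1 / (k + 2)`, which accumulate at the origin
  have hfreq : ∃ᶠ x in nhdsWithin (0 : ℂ) {0}ᶜ, P.sum x = 0 := by
    have hlim : Filter.Tendsto (fun k : ℕ => (1 : ℂ) / (((k + 1 : ℕ) : ℂ) + 1)) Filter.atTop
        (nhdsWithin (0 : ℂ) {0}ᶜ) := by
      refine tendsto_nhdsWithin_iff.2 ⟨(Filter.tendsto_add_atTop_iff_nat 1).2
        (tendsto_one_div_add_atTop_nhds_zero_nat (𝕜 := ℂ)), Filter.Eventually.of_forall fun k => ?_⟩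
      exact one_div_ne_zero (Nat.cast_add_one_ne_zero _)
    refine hlim.frequently (Filter.Frequently.of_forall fun k => ?_)
    have hk : (1 : ℝ) / (((k + 1 : ℕ) : ℝ) + 1) < 1 := by
      rw [div_lt_one (by positivity)]
      push_cast
      linarith [Nat.cast_nonneg (α := ℝ) k]
    have := (h ⟨1 / (((k + 1 : ℕ) : ℝ) + 1), by positivity, hk⟩).tsum_eq
    rw [hval]
    simpa [Param.c] using this
  have h0 := hP.eq_zero_of_eventually (hP.analyticAt.frequently_zero_iff_eventually_zero.1 hfreq)
  have hc : c = 0 := (FormalMultilinearSeries.ofScalars_series_eq_zero (𝕜 := ℂ) (E := ℂ)).1 h0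
  exact fun n => congrFun hc n

/-- The deformed product is unique. -/
theorem IsStarProduct.unique {q : Param} {f g : Pol q} {F G : PowerSeries (Pol q)}
    (hF : IsStarProduct q f g F) (hG : IsStarProduct q f g G) : F = G := by
  ext1 n
  refine (Pol.basis q).repr.injective (Finsupp.ext fun ij => ?_)
  refine sub_eq_zero.1 (eq_zero_of_hasSum_Ioo (c := fun n =>
    (Pol.basis q).repr (coeff n F) ij - (Pol.basis q).repr (coeff n G) ij) (fun t => ?_) n)
  obtain ⟨α, h1, h2⟩ := hF t
  obtain ⟨β, h3, h4⟩ := hG t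
  have := (h1 ij).sub (h3 ij)
  rw [h2.unique h4, sub_self] at this
  simpa only [mul_sub] using this

end QDisc

theorem mainTheorem1 (q : QDisc.Param) (f₁ f₂ : QDisc.Pol q) (F : PowerSeries (QDisc.Pol q)) :
    QDisc.IsStarProduct q f₁ f₂ F ↔
      F = (1 - PowerSeries.X) * PowerSeries.mk (fun j => QDisc.coeffTerm q f₁ f₂ j) := by
  constructor
  · exact fun h => h.unique (QDisc.isStarProduct_starSeries q f₁ f₂)
  · rintro rfl
    exact QDisc.isStarProduct_starSeries q f₁ f₂
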